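/- Let $v_x, v_y > 0$ be known and let $X\mid\mu \sim N_p(\mu, v_x I)$ and $Y\mid\mu \sim N_p(\mu, v_y I)$ be independent with common unknown mean $\mu\in\mathbb{R}^p$; write $p(x\mid\mu)$ and $p(y\mid\mu)$ for their densities. A predictive density estimator is a jointly measurable $\hat p(y\mid x)\ge 0$ with $\int \hat p(y\mid x)\,dy = 1$ for every $x$. Its Kullback--Leibler risk is $$R_{\mathrm{KL}}(\mu,\hat p) = \int p(x\mid\mu)\int p(y\mid\mu)\log\frac{p(y\mid\mu)}{\hat p(y\mid x)}\,dy\,dx \in [0,\infty],$$ and $\hat p$ is minimax if $\sup_\mu R_{\mathrm{KL}}(\mu,\hat p)\le \sup_\mu R_{\mathrm{KL}}(\mu,\hat q)$ for every predictive density estimator $\hat q$. Let $\pi$ be a nonzero, possibly improper, prior (a Borel measure) on $\mathbb{R}^p$. For $v>0$ let $$m_\pi(z;v) = \int (2\pi v)^{-p/2} e^{-\|z-\mu\|^2/(2v)}\,\pi(d\mu)$$ be the marginal of $Z\mid\mu\sim N_p(\mu, vI)$ (in $(2\pi v)^{-p/2}$, $\pi$ is the number), let $\pi(d\mu\mid x)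 = p(x\mid\mu)\,\pi(d\mu)/m_\pi(x;v_x)$ be the posterior, let $\hat p_\pi(y\mid x) = \int p(y\mid\mu)\,\pi(d\mu\mid x)$ be the Bayes predictive density, and put $v_w = v_xv_y/(v_x+v_y)$. Theorem. Suppose that $m_\pi(z;v_x)<\infty$ for all $z\in\mathbb{R}^p$ (so that $m_\pi(z;v)<\infty$ for all $z$ and all $0<v\le v_x$). If, for every $v$ with $v_w\le v\le v_x$, at least one of the functions $m_\pi(\cdot\,;v)$ and $\sqrt{m_\pi(\cdot\,;v)}$ is superharmonic (that is, it is $C^2$, which is automatic here, and its Laplacian is $\le 0$ everywhere), then $\hat p_\pi$ is a predictive density estimator and is minimax under $R_{\mathrm{KL}}$. -/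

import Mathlib

open MeasureTheory InformationTheory
open scoped ENNReal

noncomputable section

namespace Predictive

/-- Parameter space and sample space: `p`-dimensional Euclidean space. -/
abbrev E (p : ℕ) : Type := EuclideanSpace ℝ (Fin p)

/-- The density at `z` of the normal distribution `N_p(μ, v I)`. -/
def normalDensity {p : ℕ} (v : ℝ) (μ z : E p) : ℝ :=
  (2 * Real.pi * v) ^ (-(p : ℝ) / 2) * Real.exp (-‖z - μ‖ ^ 2 / (2 * v))

/-- The marginal `m_π(z; v) = ∫ p(z | μ) π(dμ)` of `Z | μ ~ N_p(μ, v I)` under the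
(possibly improper) prior `π`; the value `∞` is allowed. -/
def marginal {p : ℕ} (π : Measure (E p)) (v : ℝ) (z : E p) : ℝ≥0∞ :=
  ∫⁻ μ, ENNReal.ofReal (normalDensity v μ z) ∂π

/-- The (formal) posterior distribution `π(dμ | x) = p(x | μ) π(dμ) / m_π(x; v_x)` of `μ`
given `X = x`, where `X | μ ~ N_p(μ, v_x I)`. -/
def posterior {p : ℕ} (π : Measure (E p)) (vx : ℝ) (x : E p) : Measure (E p) :=
  (marginal π vx x)⁻¹ • π.withDensity (fun μ => ENNReal.ofReal (normalDensity vx μ x))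

/-- The Bayes predictive density `p̂_π(y | x) = ∫ p(y | μ) π(dμ | x)`. -/
def bayesDensity {p : ℕ} (π : Measure (E p)) (vx vy : ℝ) (x y : E p) : ℝ≥0∞ :=
  ∫⁻ μ, ENNReal.ofReal (normalDensity vy μ y) ∂(posterior π vx x)

/-- A predictive density estimator: a jointly measurable `q x y = q(y | x)` such that `q(· | x)`
is a probability density with respect to Lebesgue measure for every `x`. -/
structure IsPredictiveDensity {p : ℕ} (q : E p → E p → ℝ≥0∞) : Prop where
  measurable : Measurable (Function.uncurry q)
  lintegral_eq_one : ∀ x, ∫⁻ y, q x y = 1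

/-- The Kullback--Leibler loss `∫ p(y | μ) log (p(y | μ) / f(y)) dy ∈ [0, ∞]` of the density `f`
as an estimate of the `N_p(μ, v_y I)` density. -/
def klLoss {p : ℕ} (vy : ℝ) (μ : E p) (f : E p → ℝ≥0∞) : ℝ≥0∞ :=
  klDiv (volume.withDensity fun y => ENNReal.ofReal (normalDensity vy μ y))
    (volume.withDensity f)

/-- The Kullback--Leibler risk `R_KL(μ, q) = ∫ p(x | μ) L(μ, q(· | x)) dx ∈ [0, ∞]`. -/
def klRisk {p : ℕ} (vx vy : ℝ) (μ : E p) (q : E p → E p → ℝ≥0∞) : ℝ≥0∞ :=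
  ∫⁻ x, ENNReal.ofReal (normalDensity vx μ x) * klLoss vy μ (q x)

/-- `q` is minimax under KL risk: it is a predictive density estimator whose maximal risk does
not exceed that of any other predictive density estimator. -/
def IsMinimax {p : ℕ} (vx vy : ℝ) (q : E p → E p → ℝ≥0∞) : Prop :=
  IsPredictiveDensity q ∧
    ∀ q' : E p → E p → ℝ≥0∞, IsPredictiveDensity q' →
      (⨆ μ, klRisk vx vy μ q) ≤ (⨆ μ, klRisk vx vy μ q')

/-- A `C²` function on `ℝ^p` is superharmonic if its Laplacian is nonpositive. (Every finite
normal marginal and its square root are automatically `C²`.) -/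
def Superharmonic {p : ℕ} (f : E p → ℝ) : Prop :=
  ContDiff ℝ 2 f ∧ ∀ z, Laplacian.laplacian f z ≤ 0

end Predictive

end

namespace Predictive

open Filter Topology

variable {p : ℕ}

/-! Both sides of the minimax comparison meet at p/2 · log((v_x + v_y)/v_y), the constant risk of
the uniform-prior predictive density N(x, (v_x + v_y)I).

Upper bound. Let W = (v_y X + v_x Y)/(v_x + v_y), so that W ~ N(μ, v_w I). Factoring the product of
the two normal kernels shows that the Bayes predictive density is the uniform-prior one times m(W;
v_w)/m(X; v_x) (`bayesDensity_eq`). Its risk is therefore the constant risk plus the mean of log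
m(X; v_x) − log m(W; v_w). Given W, the law of X is N(W, (v_x − v_w)I), whatever μ is
(`pow_mul_normalDensity_mul_normalDensity`), so it suffices that a normal average of log m(·; v_x)
about w with variance v_x − v_w is at most log m(w; v_w) (`integral_log_marginal_le`). This holds
because ∂_v m = ½Δm gives ∂_v log m + ½Δ log m = Δm/m − ½|∇ log m|² = 2Δ√m/√m, which is nonpositive
if m or √m is superharmonic: log m is a supersolution of the backward heat equation
(`log_marginal_supersolution`). A minimum principle on the slab v_w ≤ v ≤ v_x
(`nonneg_of_supersolution`) turns this into the integral inequality. A quartic barrier supplies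
strictness and control at infinity, the terminal data are truncated, and both devices are then
removed in the limit.

Lower bound. For the prior N(0, τI) the Bayes predictive density g is again normal, with mean cx
where c = τ/(τ + v_x). For any competitor q, log(q/g) ≤ q/g − 1 bounds the loss of g by that of q
plus the p(·|μ)-mean of q/g minus one (`klLoss_add_one_le`), and q/g has mean one under the joint
law of prior and data. Hence the maximal risk of q is at least a bound for the risk of g that is
free of μ, and c → 1 gives the constant.

Losses and risks are kept as integrals of nonnegative functions, so that infinite values and Tonelli
need no special care. -/

/-! ### Normal kernels: mass, products, domination -/

lemma normalDensity_pos {v : ℝ} (hv : 0 < v) (μ z : E p) : 0 < normalDensity v μ z := by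
  unfold normalDensity; positivity

lemma normalDensity_nonneg {v : ℝ} (hv : 0 < v) (μ z : E p) : 0 ≤ normalDensity v μ z :=
  (normalDensity_pos hv μ z).le

lemma normalDensity_comm (v : ℝ) (μ z : E p) : normalDensity v μ z = normalDensity v z μ := by
  unfold normalDensity; rw [norm_sub_rev]

lemma measurable_normalDensity {α : Type*} [MeasurableSpace α] (v : ℝ) {f g : α → E p}
    (hf : Measurable f) (hg : Measurable g) : Measurable fun a => normalDensity v (f a) (g a) := by
  unfold normalDensity; fun_prop

lemma integral_normalDensity {v : ℝ} (hv : 0 < v) (μ : E p) :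
    ∫ z, normalDensity v μ z = 1 := by
  unfold normalDensity
  rw [integral_const_mul, integral_sub_right_eq_self (fun z : E p => Real.exp (-‖z‖ ^ 2 / (2 * v)))]
  have h := GaussianFourier.integral_rexp_neg_mul_sq_norm (V := E p)
    (b := 1 / (2 * v)) (by positivity)
  have h2 : ∀ z : E p, -‖z‖ ^ 2 / (2 * v) = -(1 / (2 * v)) * ‖z‖ ^ 2 := fun z => by ring
  simp_rw [h2]
  rw [h, finrank_euclideanSpace_fin, show Real.pi / (1 / (2 * v)) = 2 * Real.pi * v by
    field_simp, ← Real.rpow_add (by positivity)]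
  ring_nf
  simp

lemma integrable_normalDensity {v : ℝ} (hv : 0 < v) (μ : E p) :
    Integrable (fun z => normalDensity v μ z) := by
  by_contra h
  have := integral_normalDensity hv μ
  rw [integral_undef h] at this
  norm_num at this

lemma lintegral_normalDensity {v : ℝ} (hv : 0 < v) (μ : E p) :
    ∫⁻ z, ENNReal.ofReal (normalDensity v μ z) = 1 := by
  rw [← ofReal_integral_eq_lintegral_ofReal (integrable_normalDensity hv μ)
    (ae_of_all _ fun z => normalDensity_nonneg hv μ z), integral_normalDensity hv,
    ENNReal.ofReal_one]

/-- Product of two normal kernels with a common mean, factored through the precision-weighted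
average of the observations. -/
lemma normalDensity_mul_normalDensity {s t : ℝ} (hs : 0 < s) (ht : 0 < t) (μ x y : E p) :
    normalDensity s μ x * normalDensity t μ y =
      normalDensity (s + t) x y *
        normalDensity (s * t / (s + t)) μ ((s + t)⁻¹ • (t • x + s • y)) := by
  obtain ⟨A, rfl⟩ : ∃ A, x = A + μ := ⟨x - μ, by simp⟩
  obtain ⟨B, rfl⟩ : ∃ B, y = B + μ := ⟨y - μ, by simp⟩
  have hst : s + t ≠ 0 := by positivity
  have hw : (s + t)⁻¹ • (t • (A + μ) + s • (B + μ)) - μ = (s + t)⁻¹ • (t • A + s • B) := by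
    have : (s + t)⁻¹ • (t • μ + s • μ) = μ := by
      rw [← add_smul, smul_smul, add_comm t s, inv_mul_cancel₀ hst, one_smul]
    nth_rewrite 3 [← this]
    rw [← smul_sub]
    congr 1
    simp only [smul_add]
    abel
  unfold normalDensity
  simp only [hw, mul_mul_mul_comm _ (Real.exp _)]
  rw [← Real.exp_add, ← Real.exp_add,
    ← Real.mul_rpow (by positivity) (by positivity),
    ← Real.mul_rpow (by positivity) (by positivity)]
  congr 2
  · field_simp
  · have h1 : ‖(s + t)⁻¹ • (t • A + s • B)‖ ^ 2 =
        ((s + t)⁻¹) ^ 2 * (t ^ 2 * ‖A‖ ^ 2 + 2 * (t * s * inner ℝ A B) + s ^ 2 * ‖B‖ ^ 2) := by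
      rw [norm_smul, mul_pow, norm_add_sq_real, norm_smul, norm_smul, inner_smul_left,
        inner_smul_right]
      simp [mul_pow]
      left
      ring
    have h2 : ‖B + μ - (A + μ)‖ ^ 2 = ‖B‖ ^ 2 - 2 * inner ℝ A B + ‖A‖ ^ 2 := by
      rw [add_sub_add_right_eq_sub, norm_sub_sq_real, real_inner_comm]
    rw [h1, h2]
    simp only [add_sub_cancel_right]
    field_simp
    ring

lemma one_add_sq_le_exp {k : ℝ} (hk : 0 < k) {s : ℝ} (hs : 0 ≤ s) :
    (1 + s) ^ 2 ≤ 4 / k ^ 2 * Real.exp (k * (1 + s)) := by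
  have h1 : k / 2 * (1 + s) ≤ Real.exp (k / 2 * (1 + s)) :=
    (by linarith : k / 2 * (1 + s) ≤ k / 2 * (1 + s) + 1).trans (Real.add_one_le_exp _)
  have h2 : Real.exp (k * (1 + s)) = Real.exp (k / 2 * (1 + s)) ^ 2 := by
    rw [← Real.exp_nat_mul]; congr 1; push_cast; ring
  have h3 : (k / 2 * (1 + s)) ^ 2 ≤ Real.exp (k / 2 * (1 + s)) ^ 2 :=
    pow_le_pow_left₀ (by positivity) h1 2
  rw [h2]
  calc (1 + s) ^ 2 = 4 / k ^ 2 * (k / 2 * (1 + s)) ^ 2 := by field_simp; ring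
    _ ≤ _ := by gcongr

/-- A normal kernel times a quartic polynomial is dominated by a normal kernel with a larger
variance, locally uniformly in the variance and in the observation. -/
lemma exists_normalDensity_mul_le {v₁ v₂ b : ℝ} (h1 : 0 < v₁) (h12 : v₁ ≤ v₂) (h2 : v₂ < b) :
    ∃ C : ℝ, 0 ≤ C ∧ ∀ v ∈ Set.Icc v₁ v₂, ∀ μ z z' : E p, ‖z' - z‖ ≤ 1 →
      normalDensity v μ z' * (1 + ‖z' - μ‖ ^ 2) ^ 2 ≤ C * normalDensity b μ z := by
  have hv2 : 0 < v₂ := h1.trans_le h12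
  have hb : 0 < b := hv2.trans h2
  -- The constants κ and η satisfy κ + (1 + η)/(2b) = 1/(2v₂). The Gaussian decay at variance v₂
  -- thus pays both for the polynomial, through exp(κ(1 + r²)), and for the passage to variance b at
  -- the shifted point, through R² ≤ (1 + η)r² + 1 + 1/η.
  set κ := (b - v₂) / (4 * v₂ * b) with hκ
  have hκ0 : 0 < κ := by
    have : 0 < b - v₂ := by linarith
    positivity
  set η := (b - v₂) / (2 * v₂) with hη
  have hη0 : 0 < η := by
    have : 0 < b - v₂ := by linarith
    positivity
  set C0 := (2 * Real.pi * v₁) ^ (-(p : ℝ) / 2) with hC0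
  set C1 := (2 * Real.pi * b) ^ (-(p : ℝ) / 2) with hC1
  have hC0' : 0 < C0 := by positivity
  have hC1' : 0 < C1 := by positivity
  set K := (4 / κ ^ 2) * Real.exp (κ + (1 + 1 / η) / (2 * b)) with hK
  have hK0 : 0 < K := by positivity
  refine ⟨C0 / C1 * K, by positivity, ?_⟩
  intro v hv μ z z' hz
  have hv0 : 0 < v := h1.trans_le hv.1
  set r := ‖z' - μ‖ with hr
  set R := ‖z - μ‖ with hR
  have hr0 : 0 ≤ r := norm_nonneg _
  have hR0 : 0 ≤ R := norm_nonneg _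
  have hRr : R ≤ r + 1 := by
    have : z - μ = (z' - μ) - (z' - z) := by abel
    rw [hR, this]
    exact (norm_sub_le _ _).trans (by linarith)
  have hR2 : R ^ 2 ≤ (1 + η) * r ^ 2 + (1 + 1 / η) := by
    have h3 : R ^ 2 ≤ (r + 1) ^ 2 := pow_le_pow_left₀ hR0 hRr 2
    have h4 : 2 * r ≤ η * r ^ 2 + 1 / η := by
      have : 0 ≤ (η * r - 1) ^ 2 / η := by positivity
      have e : (η * r - 1) ^ 2 / η = η * r ^ 2 - 2 * r + 1 / η := by field_simp; ring
      linarith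
    nlinarith
  have hpre : (2 * Real.pi * v) ^ (-(p : ℝ) / 2) ≤ C0 := by
    apply Real.rpow_le_rpow_of_nonpos (by positivity)
    · have := Real.pi_pos
      have := hv.1
      gcongr
    · have : (0 : ℝ) ≤ p := Nat.cast_nonneg p
      linarith
  have hexp : Real.exp (-r ^ 2 / (2 * v)) * (1 + r ^ 2) ^ 2 ≤ K * Real.exp (-R ^ 2 / (2 * b)) := by
    have h5 := one_add_sq_le_exp hκ0 (sq_nonneg r)
    have h6 : -r ^ 2 / (2 * v) ≤ -r ^ 2 / (2 * v₂) := by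
      rw [neg_div, neg_div, neg_le_neg_iff]
      have := hv.2
      gcongr
    have h7 : R ^ 2 / (2 * b) ≤ ((1 + η) * r ^ 2 + (1 + 1 / η)) / (2 * b) := by gcongr
    have h8 : -r ^ 2 / (2 * v₂) + κ * (1 + r ^ 2) + ((1 + η) * r ^ 2) / (2 * b) = κ := by
      rw [hκ, hη]; field_simp; ring
    have h9 : -r ^ 2 / (2 * v) + κ * (1 + r ^ 2) ≤
        (κ + (1 + 1 / η) / (2 * b)) + -R ^ 2 / (2 * b) := by
      rw [add_div] at h7
      rw [neg_div _ (R ^ 2)]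
      linarith
    calc Real.exp (-r ^ 2 / (2 * v)) * (1 + r ^ 2) ^ 2
        ≤ Real.exp (-r ^ 2 / (2 * v)) * (4 / κ ^ 2 * Real.exp (κ * (1 + r ^ 2))) := by gcongr
      _ = 4 / κ ^ 2 * Real.exp (-r ^ 2 / (2 * v) + κ * (1 + r ^ 2)) := by
          rw [Real.exp_add]; ring
      _ ≤ 4 / κ ^ 2 * Real.exp ((κ + (1 + 1 / η) / (2 * b)) + -R ^ 2 / (2 * b)) := by gcongr
      _ = _ := by rw [Real.exp_add, hK]; ring
  unfold normalDensity
  rw [← hr, ← hR, ← hC1]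
  calc (2 * Real.pi * v) ^ (-(p : ℝ) / 2) * Real.exp (-r ^ 2 / (2 * v)) * (1 + r ^ 2) ^ 2
      = (2 * Real.pi * v) ^ (-(p : ℝ) / 2) *
        (Real.exp (-r ^ 2 / (2 * v)) * (1 + r ^ 2) ^ 2) := by ring
    _ ≤ C0 * (K * Real.exp (-R ^ 2 / (2 * b))) := by gcongr
    _ = _ := by field_simp

/-! ### Second derivatives along lines -/

/-- `g` is twice differentiable at `0` with second derivative `d`. -/
def HasSecondDerivAtZero (g : ℝ → ℝ) (d : ℝ) : Prop :=
  ∃ g' : ℝ → ℝ, (∀ᶠ s in 𝓝 0, HasDerivAt g (g' s) s) ∧ HasDerivAt g' d 0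

lemma HasSecondDerivAtZero.add {f g : ℝ → ℝ} {a b : ℝ} (hf : HasSecondDerivAtZero f a)
    (hg : HasSecondDerivAtZero g b) : HasSecondDerivAtZero (fun s => f s + g s) (a + b) := by
  obtain ⟨f', hf1, hf2⟩ := hf
  obtain ⟨g', hg1, hg2⟩ := hg
  exact ⟨fun s => f' s + g' s, by filter_upwards [hf1, hg1] with s h1 h2 using h1.add h2,
    hf2.add hg2⟩

lemma HasSecondDerivAtZero.const_mul {f : ℝ → ℝ} {a : ℝ} (c : ℝ)
    (hf : HasSecondDerivAtZero f a) : HasSecondDerivAtZero (fun s => c * f s) (c * a) := by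
  obtain ⟨f', hf1, hf2⟩ := hf
  exact ⟨fun s => c * f' s, by filter_upwards [hf1] with s h1 using h1.const_mul c,
    hf2.const_mul c⟩

lemma HasSecondDerivAtZero.add_const {f : ℝ → ℝ} {a : ℝ} (hf : HasSecondDerivAtZero f a)
    (c : ℝ) : HasSecondDerivAtZero (fun s => f s + c) a := by
  obtain ⟨f', hf1, hf2⟩ := hf
  exact ⟨f', by filter_upwards [hf1] with s h1 using h1.add_const c, hf2⟩

lemma HasSecondDerivAtZero.deriv_deriv {f : ℝ → ℝ} {a : ℝ} (hf : HasSecondDerivAtZero f a) :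
    deriv (deriv f) 0 = a := by
  obtain ⟨f', hf1, hf2⟩ := hf
  have : deriv f =ᶠ[𝓝 0] f' := by filter_upwards [hf1] with s hs using hs.deriv
  rw [this.deriv_eq, hf2.deriv]

lemma HasSecondDerivAtZero.continuousAt {f : ℝ → ℝ} {a : ℝ} (hf : HasSecondDerivAtZero f a) :
    ContinuousAt f 0 := by
  obtain ⟨f', hf1, -⟩ := hf
  exact hf1.self_of_nhds.continuousAt

lemma HasSecondDerivAtZero.unique {f : ℝ → ℝ} {a b : ℝ} (ha : HasSecondDerivAtZero f a)
    (hb : HasSecondDerivAtZero f b) : a = b := by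
  rw [← ha.deriv_deriv, hb.deriv_deriv]

/-- A negative second derivative would make 0 a local maximum as well, so the function would be
constant near 0 and its second derivative zero. -/
lemma HasSecondDerivAtZero.nonneg_of_isLocalMin {f : ℝ → ℝ} {a : ℝ}
    (hf : HasSecondDerivAtZero f a) (hmin : IsLocalMin f 0) : 0 ≤ a := by
  by_contra! ha
  have h1 := hf.const_mul (-1)
  have hmax : IsLocalMax (fun s => -1 * f s) 0 := by
    filter_upwards [hmin] with s hs using by linarith
  have hmin' : IsLocalMin (fun s => -1 * f s) 0 :=
    isLocalMin_of_deriv_deriv_pos (by rw [h1.deriv_deriv]; linarith) hmax.deriv_eq_zero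
      h1.continuousAt
  have hc : (fun s => -1 * f s) =ᶠ[𝓝 0] fun _ => -1 * f 0 := by
    filter_upwards [hmax, hmin'] with s h2 h3 using le_antisymm h2 h3
  have h4 := h1.deriv_deriv
  rw [hc.deriv.deriv_eq] at h4
  simp at h4
  linarith

/-! ### Derivatives of the normal kernel in variance and position -/

lemma hasDerivAt_normalDensity_variance {v : ℝ} (hv : 0 < v) (μ z : E p) :
    HasDerivAt (fun v => normalDensity v μ z)
      (normalDensity v μ z * (‖z - μ‖ ^ 2 / (2 * v ^ 2) - p / (2 * v))) v := by
  unfold normalDensity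
  have hπ := Real.pi_pos
  have h1 : HasDerivAt (fun v : ℝ => (2 * Real.pi * v) ^ (-(p : ℝ) / 2))
      ((2 * Real.pi) * (-(p : ℝ) / 2) * (2 * Real.pi * v) ^ (-(p : ℝ) / 2 - 1)) v := by
    have := (((hasDerivAt_id v).const_mul (2 * Real.pi))).rpow_const (p := -(p : ℝ) / 2)
      (Or.inl (by simp; positivity))
    simpa using this
  have h2 : HasDerivAt (fun v : ℝ => Real.exp (-‖z - μ‖ ^ 2 / (2 * v)))
      (Real.exp (-‖z - μ‖ ^ 2 / (2 * v)) * (‖z - μ‖ ^ 2 / (2 * v ^ 2))) v := by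
    have h3 : HasDerivAt (fun v : ℝ => -‖z - μ‖ ^ 2 / (2 * v)) (‖z - μ‖ ^ 2 / (2 * v ^ 2)) v := by
      have := (hasDerivAt_const v (-‖z - μ‖ ^ 2)).div ((hasDerivAt_id v).const_mul 2)
        (by simp; positivity)
      refine this.congr_deriv ?_
      simp
      field_simp
    exact h3.exp
  refine (h1.mul h2).congr_deriv ?_
  rw [Real.rpow_sub_one (by positivity)]
  field_simp
  ring

lemma hasDerivAt_normalDensity_line {v : ℝ} (hv : 0 < v) (μ z e : E p) (s : ℝ) :
    HasDerivAt (fun s : ℝ => normalDensity v μ (z + s • e))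
      (normalDensity v μ (z + s • e) * (-(inner ℝ (z + s • e - μ) e) / v)) s := by
  unfold normalDensity
  have h0 : HasDerivAt (fun s : ℝ => z + s • e - μ) e s := by
    simpa using (((hasDerivAt_id s).smul_const e).const_add z).sub_const μ
  have h1 : HasDerivAt (fun s : ℝ => -‖z + s • e - μ‖ ^ 2 / (2 * v))
      (-(inner ℝ (z + s • e - μ) e) / v) s := by
    refine ((h0.norm_sq.neg).div_const (2 * v)).congr_deriv ?_
    field_simp
  refine ((h1.exp).const_mul ((2 * Real.pi * v) ^ (-(p : ℝ) / 2))).congr_deriv ?_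
  ring

lemma hasDerivAt_normalDensity_line_two {v : ℝ} (hv : 0 < v) (μ z e : E p) (s : ℝ) :
    HasDerivAt
      (fun s : ℝ => normalDensity v μ (z + s • e) * (-(inner ℝ (z + s • e - μ) e) / v))
      (normalDensity v μ (z + s • e) *
        (inner ℝ (z + s • e - μ) e ^ 2 / v ^ 2 - ‖e‖ ^ 2 / v)) s := by
  have h0 : HasDerivAt (fun s : ℝ => z + s • e - μ) e s := by
    simpa using (((hasDerivAt_id s).smul_const e).const_add z).sub_const μ
  have h1 : HasDerivAt (fun s : ℝ => -(inner ℝ (z + s • e - μ) e) / v) (-‖e‖ ^ 2 / v) s := by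
    have := ((h0.inner ℝ (hasDerivAt_const s e)).neg).div_const v
    simpa using this
  refine ((hasDerivAt_normalDensity_line hv μ z e s).mul h1).congr_deriv ?_
  field_simp
  ring

/-! ### Normal smoothings: differentiation under the integral and the heat equation -/

section Smoothing

variable {π : Measure (E p)} {φ : E p → ℝ} {K b : ℝ}

lemma aestronglyMeasurable_mul_normalDensity_mul (hφm : Measurable φ) (v : ℝ) (z : E p)
    {f : E p → ℝ} (hf : Continuous f) :
    AEStronglyMeasurable (fun μ => φ μ * (normalDensity v μ z * f μ)) π :=
  (hφm.mul ((measurable_normalDensity v measurable_id measurable_const).mul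
    hf.measurable)).aestronglyMeasurable

lemma norm_mul_normalDensity_mul_le (hφ : ∀ μ, |φ μ| ≤ K) {v : ℝ} (hv : 0 < v) {C c : ℝ}
    {μ z z' : E p} {f : ℝ} (hf : |f| ≤ c * (1 + ‖z' - μ‖ ^ 2) ^ 2)
    (h : normalDensity v μ z' * (1 + ‖z' - μ‖ ^ 2) ^ 2 ≤ C * normalDensity b μ z)
    (hc : 0 ≤ c) :
    ‖φ μ * (normalDensity v μ z' * f)‖ ≤ K * (c * (C * normalDensity b μ z)) := by
  have hN := normalDensity_nonneg hv μ z'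
  have hK : 0 ≤ K := (abs_nonneg _).trans (hφ μ)
  rw [norm_mul, norm_mul, Real.norm_of_nonneg hN, Real.norm_eq_abs, Real.norm_eq_abs]
  calc |φ μ| * (normalDensity v μ z' * |f|)
      ≤ K * (normalDensity v μ z' * (c * (1 + ‖z' - μ‖ ^ 2) ^ 2)) := by
        gcongr; exact hφ μ
    _ = K * (c * (normalDensity v μ z' * (1 + ‖z' - μ‖ ^ 2) ^ 2)) := by ring
    _ ≤ _ := by gcongr

lemma one_le_quartic (r : ℝ) : 1 ≤ (1 + r ^ 2) ^ 2 := by nlinarith [sq_nonneg r]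

lemma le_quartic (r : ℝ) : r ≤ (1 + r ^ 2) ^ 2 := by nlinarith [sq_nonneg r, sq_nonneg (r - 1)]

lemma sq_le_quartic (r : ℝ) : r ^ 2 ≤ (1 + r ^ 2) ^ 2 := by nlinarith [sq_nonneg r]

variable (hφm : Measurable φ) (hφ : ∀ μ, |φ μ| ≤ K)

include hφm hφ in
-- Weight and measure are both left general for two uses: weight one against the prior gives the
-- marginals, and a bounded weight against Lebesgue measure gives the heat flow. Integrability is
-- known only at variance b, which is why v < b is strict here and below.
lemma integrable_mul_normalDensity_mul {z : E p}
    (hint : Integrable (fun μ => normalDensity b μ z) π) {v : ℝ} (hv : 0 < v) (hvb : v < b)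
    {f : E p → ℝ} (hf : Continuous f) {c : ℝ} (hc : 0 ≤ c)
    (hfc : ∀ μ, |f μ| ≤ c * (1 + ‖z - μ‖ ^ 2) ^ 2) :
    Integrable (fun μ => φ μ * (normalDensity v μ z * f μ)) π := by
  obtain ⟨C, -, hC⟩ := exists_normalDensity_mul_le (p := p) hv le_rfl hvb
  refine (((hint.const_mul C).const_mul c).const_mul K).mono'
    (aestronglyMeasurable_mul_normalDensity_mul hφm v z hf) (ae_of_all _ fun μ => ?_)
  exact norm_mul_normalDensity_mul_le hφ hv (hfc μ) (hC v ⟨le_rfl, le_rfl⟩ μ z z (by simp)) hc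

include hφm hφ in
/-- Derivative in the variance of a normal smoothing. -/
lemma hasDerivAt_smoothing_variance {z : E p}
    (hint : Integrable (fun μ => normalDensity b μ z) π) {v : ℝ} (hv : 0 < v) (hvb : v < b) :
    HasDerivAt (fun v => ∫ μ, φ μ * normalDensity v μ z ∂π)
      (∫ μ, φ μ * (normalDensity v μ z * (‖z - μ‖ ^ 2 / (2 * v ^ 2) - p / (2 * v))) ∂π) v := by
  -- Between v/2 and (v + b)/2 the variance stays away from 0 and below b, so one kernel of variance
  -- b dominates the derivative throughout the neighbourhood.
  obtain ⟨C, hC0, hC⟩ := exists_normalDensity_mul_le (p := p) (v₁ := v / 2) (v₂ := (v + b) / 2)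
    (b := b) (by linarith) (by linarith) (by linarith)
  set c : ℝ := 1 / (2 * (v / 2) ^ 2) + p / (2 * (v / 2)) with hc
  have hc0 : 0 ≤ c := by positivity
  refine (hasDerivAt_integral_of_dominated_loc_of_deriv_le
    (F := fun v μ => φ μ * normalDensity v μ z)
    (F' := fun v μ => φ μ * (normalDensity v μ z * (‖z - μ‖ ^ 2 / (2 * v ^ 2) - p / (2 * v))))
    (bound := fun μ => K * (c * (C * normalDensity b μ z)))
    (Icc_mem_nhds (by linarith : v / 2 < v) (by linarith : v < (v + b) / 2))
    (Eventually.of_forall fun w => ?_) ?_ ?_ ?_ ?_ ?_).2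
  · simpa using aestronglyMeasurable_mul_normalDensity_mul hφm w z (continuous_const (y := (1 : ℝ)))
  · simpa using integrable_mul_normalDensity_mul hφm hφ hint hv hvb
      (continuous_const (y := (1 : ℝ))) zero_le_one (fun μ => by simpa using one_le_quartic _)
  · exact aestronglyMeasurable_mul_normalDensity_mul hφm v z (by fun_prop)
  · refine ae_of_all _ fun μ w hw => ?_
    have hw0 : 0 < w := by linarith [hw.1]
    refine norm_mul_normalDensity_mul_le hφ hw0 ?_ (hC w hw μ z z (by simp)) hc0
    have h1 : |‖z - μ‖ ^ 2 / (2 * w ^ 2) - p / (2 * w)| ≤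
        ‖z - μ‖ ^ 2 / (2 * w ^ 2) + p / (2 * w) := by
      refine (abs_sub _ _).trans_eq ?_
      rw [abs_of_nonneg (by positivity), abs_of_nonneg (by positivity)]
    have h2 : ‖z - μ‖ ^ 2 / (2 * w ^ 2) + p / (2 * w) ≤
        (1 + ‖z - μ‖ ^ 2) ^ 2 / (2 * (v / 2) ^ 2) + p * (1 + ‖z - μ‖ ^ 2) ^ 2 / (2 * (v / 2)) := by
      have := hw.1
      gcongr ?_ / (2 * ?_ ^ 2) + ?_ / (2 * ?_)
      · exact sq_le_quartic _
      · exact le_mul_of_one_le_right (by positivity) (one_le_quartic _)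
    refine h1.trans (h2.trans_eq ?_)
    rw [hc]; ring
  · exact ((hint.const_mul C).const_mul c).const_mul K
  · refine ae_of_all _ fun μ w hw => ?_
    exact (hasDerivAt_normalDensity_variance (by linarith [hw.1]) μ z).const_mul _

include hφm hφ in
/-- Second derivative along a line of a normal smoothing. -/
lemma hasSecondDerivAtZero_smoothing {z : E p}
    (hint : ∀ z, Integrable (fun μ => normalDensity b μ z) π) {v : ℝ} (hv : 0 < v) (hvb : v < b)
    {e : E p} (he : ‖e‖ = 1) :
    HasSecondDerivAtZero (fun s => ∫ μ, φ μ * normalDensity v μ (z + s • e) ∂π)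
      (∫ μ, φ μ * (normalDensity v μ z * (inner ℝ (z - μ) e ^ 2 / v ^ 2 - 1 / v)) ∂π) := by
  obtain ⟨C, hC0, hC⟩ := exists_normalDensity_mul_le (p := p) hv le_rfl hvb
  have hnear : ∀ s ∈ Metric.ball (0 : ℝ) 1, ‖(z + s • e) - z‖ ≤ 1 := by
    intro s hs
    rw [Metric.mem_ball, dist_zero_right] at hs
    rw [add_sub_cancel_left, norm_smul, he, mul_one]
    exact hs.le
  have hin : ∀ x : E p, |inner ℝ x e| ≤ ‖x‖ := fun x => by
    simpa [he] using abs_real_inner_le_norm x e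
  have hb1 : ∀ x : E p, |-(inner ℝ x e) / v| ≤ 1 / v * (1 + ‖x‖ ^ 2) ^ 2 := fun x => by
    rw [abs_div, abs_neg, abs_of_pos hv, div_mul_eq_mul_div, one_mul]
    gcongr
    exact (hin x).trans (le_quartic _)
  have hb2 : ∀ x : E p, |inner ℝ x e ^ 2 / v ^ 2 - ‖e‖ ^ 2 / v| ≤
      (1 / v ^ 2 + 1 / v) * (1 + ‖x‖ ^ 2) ^ 2 := fun x => by
    refine (abs_sub _ _).trans ?_
    rw [abs_of_nonneg (by positivity), abs_of_nonneg (by positivity), he, one_pow, add_mul,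
      div_mul_eq_mul_div, div_mul_eq_mul_div, one_mul]
    gcongr ?_ / _ + ?_ / _
    · rw [← sq_abs]
      exact (pow_le_pow_left₀ (abs_nonneg _) (hin x) 2).trans (sq_le_quartic _)
    · exact one_le_quartic _
  refine ⟨fun s => ∫ μ, φ μ *
    (normalDensity v μ (z + s • e) * (-(inner ℝ (z + s • e - μ) e) / v)) ∂π, ?_, ?_⟩
  · filter_upwards [Metric.ball_mem_nhds (0 : ℝ) one_pos] with s hs
    refine (hasDerivAt_integral_of_dominated_loc_of_deriv_le
      (F := fun s μ => φ μ * normalDensity v μ (z + s • e))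
      (F' := fun s μ => φ μ * (normalDensity v μ (z + s • e) *
        (-(inner ℝ (z + s • e - μ) e) / v)))
      (bound := fun μ => K * (1 / v * (C * normalDensity b μ z)))
      (Metric.isOpen_ball.mem_nhds hs)
      (Eventually.of_forall fun w => ?_) ?_ ?_ ?_ ?_ ?_).2
    · simpa using aestronglyMeasurable_mul_normalDensity_mul hφm v (z + w • e)
        (continuous_const (y := (1 : ℝ)))
    · simpa using integrable_mul_normalDensity_mul hφm hφ (hint _) hv hvb
        (continuous_const (y := (1 : ℝ))) zero_le_one (fun μ => by simpa using one_le_quartic _)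
    · exact aestronglyMeasurable_mul_normalDensity_mul hφm v _ (by fun_prop)
    · refine ae_of_all _ fun μ w hw => ?_
      exact norm_mul_normalDensity_mul_le hφ hv (hb1 _)
        (hC v ⟨le_rfl, le_rfl⟩ μ z _ (hnear w hw)) (by positivity)
    · exact (((hint z).const_mul C).const_mul (1 / v)).const_mul K
    · exact ae_of_all _ fun μ w _ => (hasDerivAt_normalDensity_line hv μ z e w).const_mul _
  · have := (hasDerivAt_integral_of_dominated_loc_of_deriv_le (μ := π) (x₀ := (0 : ℝ))
      (F := fun s μ => φ μ * (normalDensity v μ (z + s • e) *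
        (-(inner ℝ (z + s • e - μ) e) / v)))
      (F' := fun s μ => φ μ * (normalDensity v μ (z + s • e) *
        (inner ℝ (z + s • e - μ) e ^ 2 / v ^ 2 - ‖e‖ ^ 2 / v)))
      (bound := fun μ => K * ((1 / v ^ 2 + 1 / v) * (C * normalDensity b μ z)))
      (Metric.ball_mem_nhds (0 : ℝ) one_pos)
      (Eventually.of_forall fun w =>
        aestronglyMeasurable_mul_normalDensity_mul hφm v _ (by fun_prop))
      (integrable_mul_normalDensity_mul hφm hφ (hint _) hv hvb (by fun_prop)
        (c := 1 / v) (by positivity) (fun μ => hb1 _))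
      (aestronglyMeasurable_mul_normalDensity_mul hφm v _ (by fun_prop))
      (ae_of_all _ fun μ w hw => norm_mul_normalDensity_mul_le hφ hv (hb2 _)
        (hC v ⟨le_rfl, le_rfl⟩ μ z _ (hnear w hw)) (by positivity))
      ((((hint z).const_mul C).const_mul _).const_mul K)
      (ae_of_all _ fun μ w _ => (hasDerivAt_normalDensity_line_two hv μ z e w).const_mul _)).2
    simpa [he] using this

lemma sum_inner_single_sq (x : E p) :
    ∑ i, inner ℝ x (EuclideanSpace.single i (1 : ℝ)) ^ 2 = ‖x‖ ^ 2 := by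
  rw [EuclideanSpace.norm_sq_eq]
  simp [EuclideanSpace.inner_single_right]

include hφm hφ in
/-- The heat equation for normal smoothings. -/
lemma sum_integral_smoothing {z : E p}
    (hint : Integrable (fun μ => normalDensity b μ z) π) {v : ℝ} (hv : 0 < v) (hvb : v < b) :
    ∑ i, ∫ μ, φ μ * (normalDensity v μ z *
      (inner ℝ (z - μ) (EuclideanSpace.single i (1 : ℝ)) ^ 2 / v ^ 2 - 1 / v)) ∂π =
    2 * ∫ μ, φ μ * (normalDensity v μ z * (‖z - μ‖ ^ 2 / (2 * v ^ 2) - p / (2 * v))) ∂π := by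
  rw [← integral_finsetSum, ← integral_const_mul]
  · congr 1 with μ
    rw [← Finset.mul_sum, ← Finset.mul_sum, Finset.sum_sub_distrib, ← Finset.sum_div,
      sum_inner_single_sq]
    simp
    field_simp
  · intro i _
    refine integrable_mul_normalDensity_mul hφm hφ hint hv hvb (by fun_prop)
      (c := 1 / v ^ 2 + 1 / v) (by positivity) (fun μ => ?_)
    refine (abs_sub _ _).trans ?_
    rw [abs_of_nonneg (by positivity), abs_of_nonneg (by positivity), add_mul,
      div_mul_eq_mul_div, div_mul_eq_mul_div, one_mul]
    gcongr ?_ / _ + ?_ / _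
    · rw [← sq_abs]
      refine (pow_le_pow_left₀ (abs_nonneg _) ?_ 2).trans (sq_le_quartic ‖z - μ‖)
      simpa using abs_real_inner_le_norm (z - μ) (EuclideanSpace.single i (1 : ℝ))
    · exact one_le_quartic _

end Smoothing

/-! ### Moments of the normal distribution -/

/-- The kernel is symmetric in mean and observation, so Lebesgue measure may play the prior in the
smoothing lemma; what remains is to recentre the quartic from a to μ. -/
lemma integrable_quartic_mul_normalDensity {v : ℝ} (hv : 0 < v) (μ a : E p) {f : E p → ℝ}
    (hf : Continuous f) {c : ℝ} (hc : ∀ y, |f y| ≤ c * (1 + ‖y - a‖ ^ 2) ^ 2) :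
    Integrable (fun y => normalDensity v μ y * f y) := by
  have h1 : ∀ y : E p, (1 + ‖y - a‖ ^ 2) ^ 2 ≤
      4 * (1 + ‖μ - a‖ ^ 2) ^ 2 * (1 + ‖μ - y‖ ^ 2) ^ 2 := fun y => by
    have h2 : ‖y - a‖ ^ 2 ≤ 2 * ‖μ - a‖ ^ 2 + 2 * ‖μ - y‖ ^ 2 := by
      have : ‖y - a‖ ≤ ‖μ - a‖ + ‖μ - y‖ := by
        have e : y - a = (μ - a) - (μ - y) := by abel
        rw [e]; exact norm_sub_le _ _
      have := pow_le_pow_left₀ (norm_nonneg _) this 2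
      nlinarith [sq_nonneg (‖μ - a‖ - ‖μ - y‖)]
    have h3 : 1 + ‖y - a‖ ^ 2 ≤ 2 * ((1 + ‖μ - a‖ ^ 2) * (1 + ‖μ - y‖ ^ 2)) := by
      nlinarith [mul_nonneg (sq_nonneg ‖μ - a‖) (sq_nonneg ‖μ - y‖)]
    calc (1 + ‖y - a‖ ^ 2) ^ 2 ≤ (2 * ((1 + ‖μ - a‖ ^ 2) * (1 + ‖μ - y‖ ^ 2))) ^ 2 := by gcongr
      _ = _ := by ring
  have hc0 : 0 ≤ c := by
    have := (abs_nonneg _).trans (hc 0)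
    by_contra! h
    have h4 := one_le_quartic ‖(0 : E p) - a‖
    nlinarith
  have := integrable_mul_normalDensity_mul (π := volume) (φ := fun _ => (1 : ℝ)) (K := 1)
    (b := 2 * v) (z := μ) measurable_const (by simp)
    (by simpa only [normalDensity_comm] using integrable_normalDensity (by positivity) μ) hv
    (by linarith) hf (c := c * (4 * (1 + ‖μ - a‖ ^ 2) ^ 2)) (by positivity) (fun y => by
      rw [mul_assoc]
      exact (hc y).trans (mul_le_mul_of_nonneg_left (h1 y) hc0))
  simpa only [one_mul, normalDensity_comm v _ μ] using this

lemma integrable_normalDensity_mul_norm_sub_sq {v : ℝ} (hv : 0 < v) (μ a : E p) :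
    Integrable (fun y => normalDensity v μ y * ‖y - a‖ ^ 2) :=
  integrable_quartic_mul_normalDensity hv μ a (by fun_prop) (c := 1) fun y => by
    rw [abs_of_nonneg (by positivity), one_mul]; exact sq_le_quartic _

/-- Total mass one holds at every variance; differentiating it in v yields the second moment. -/
lemma integral_normalDensity_mul_norm_sub_mean_sq {v : ℝ} (hv : 0 < v) (μ : E p) :
    ∫ y, normalDensity v μ y * ‖y - μ‖ ^ 2 = p * v := by
  have h := hasDerivAt_smoothing_variance (π := volume) (φ := fun _ => (1 : ℝ)) (K := 1)
    (b := 2 * v) (z := μ) measurable_const (by simp)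
    (by simpa only [normalDensity_comm] using integrable_normalDensity (by positivity) μ) hv
    (by linarith)
  have h2 : (fun v => ∫ y, (1 : ℝ) * normalDensity v y μ) =ᶠ[𝓝 v] fun _ => 1 := by
    filter_upwards [lt_mem_nhds hv] with w hw
    simp only [one_mul, normalDensity_comm w _ μ]
    exact integral_normalDensity hw μ
  have h3 := h.unique ((hasDerivAt_const v (1 : ℝ)).congr_of_eventuallyEq h2)
  have h4 : ∀ y, (1 : ℝ) * (normalDensity v y μ * (‖μ - y‖ ^ 2 / (2 * v ^ 2) - p / (2 * v))) =
      (normalDensity v μ y * ‖y - μ‖ ^ 2) * (1 / (2 * v ^ 2)) -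
        normalDensity v μ y * (p / (2 * v)) := fun y => by
    rw [normalDensity_comm v y μ, norm_sub_rev]; ring
  simp_rw [h4] at h3
  rw [integral_sub ((integrable_normalDensity_mul_norm_sub_sq hv μ μ).mul_const _)
    ((integrable_normalDensity hv μ).mul_const _), integral_mul_const, integral_mul_const,
    integral_normalDensity hv] at h3
  field_simp at h3
  linarith

/-- The integrand is odd under reflection in μ. -/
lemma integral_normalDensity_mul_inner {v : ℝ} (μ c : E p) :
    ∫ y, normalDensity v μ y * inner ℝ (y - μ) c = 0 := by
  have h := integral_sub_left_eq_self
    (fun y => normalDensity v μ y * inner ℝ (y - μ) c) volume (μ + μ)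
  have h2 : ∀ y : E p, normalDensity v μ (μ + μ - y) * inner ℝ (μ + μ - y - μ) c =
      -(normalDensity v μ y * inner ℝ (y - μ) c) := fun y => by
    have : μ + μ - y - μ = -(y - μ) := by abel
    unfold normalDensity
    rw [this, norm_neg, inner_neg_left]; ring
  simp_rw [h2] at h
  rw [integral_neg] at h
  linarith

lemma integral_normalDensity_mul_norm_sub_sq {v : ℝ} (hv : 0 < v) (μ a : E p) :
    ∫ y, normalDensity v μ y * ‖y - a‖ ^ 2 = p * v + ‖μ - a‖ ^ 2 := by
  have h1 : ∀ y : E p, normalDensity v μ y * ‖y - a‖ ^ 2 =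
      normalDensity v μ y * ‖y - μ‖ ^ 2 + (normalDensity v μ y * inner ℝ (y - μ) (μ - a) * 2 +
        normalDensity v μ y * ‖μ - a‖ ^ 2) := fun y => by
    have : y - a = (y - μ) + (μ - a) := by abel
    rw [this, norm_add_sq_real]; ring
  have hi : Integrable (fun y => normalDensity v μ y * inner ℝ (y - μ) (μ - a)) :=
    integrable_quartic_mul_normalDensity hv μ μ (by fun_prop) (c := ‖μ - a‖) fun y => by
      rw [mul_comm]
      exact (abs_real_inner_le_norm _ _).trans
        (mul_le_mul_of_nonneg_right (le_quartic _) (norm_nonneg _))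
  have hi2 : Integrable (fun y => normalDensity v μ y * inner ℝ (y - μ) (μ - a) * 2 +
      normalDensity v μ y * ‖μ - a‖ ^ 2) :=
    (hi.mul_const _).add ((integrable_normalDensity hv μ).mul_const _)
  simp_rw [h1]
  rw [integral_add (integrable_normalDensity_mul_norm_sub_sq hv μ μ) hi2,
    integral_add (hi.mul_const _) ((integrable_normalDensity hv μ).mul_const _),
    integral_mul_const, integral_mul_const, integral_normalDensity_mul_inner,
    integral_normalDensity hv, integral_normalDensity_mul_norm_sub_mean_sq hv]
  ring

/-! ### Minimum principle for the backward heat equation -/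

/-- A minimum over a time interval may sit at its initial time, so only slopes to the right are
available; they suffice. -/
lemma HasDerivAt.nonneg_of_isMinOn_Ico {f : ℝ → ℝ} {d t b : ℝ} (hf : HasDerivAt f d t)
    (htb : t < b) (hmin : ∀ s ∈ Set.Ico t b, f t ≤ f s) : 0 ≤ d := by
  have h1 := (hasDerivAt_iff_tendsto_slope.1 hf).mono_left
    (nhdsWithin_mono t (fun x (hx : x ∈ Set.Ioi t) => ne_of_gt hx))
  refine ge_of_tendsto h1 ?_
  filter_upwards [Ioo_mem_nhdsGT htb] with s hs
  rw [slope_def_field]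
  exact div_nonneg (sub_nonneg.2 (hmin s ⟨hs.1.le, hs.2⟩)) (by linarith [hs.1])

/-- Minimum principle for strict supersolutions of the backward heat equation on a slab. -/
lemma nonneg_of_supersolution {a b R : ℝ} {Ψ : E p → ℝ → ℝ}
    (hlsc : LowerSemicontinuousOn (Function.uncurry Ψ) (Set.univ ×ˢ Set.Icc a b))
    (hfar : ∀ z, ∀ t ∈ Set.Icc a b, R < ‖z‖ → 0 ≤ Ψ z t)
    (hend : ∀ z, 0 ≤ Ψ z b)
    (hpde : ∀ z, ∀ t ∈ Set.Ico a b, ∃ (d : ℝ) (D : Fin p → ℝ), HasDerivAt (Ψ z) d t ∧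
      (∀ i, HasSecondDerivAtZero (fun s => Ψ (z + s • EuclideanSpace.single i (1 : ℝ)) t) (D i)) ∧
      d + 1 / 2 * ∑ i, D i < 0) (z : E p) {t : ℝ} (ht : t ∈ Set.Icc a b) : 0 ≤ Ψ z t := by
  by_contra! hneg
  have hzR : ∀ z, ∀ t ∈ Set.Icc a b, Ψ z t < 0 → z ∈ Metric.closedBall (0 : E p) R := by
    intro z t ht h
    rw [mem_closedBall_zero_iff]
    by_contra! h2
    exact absurd (hfar z t ht h2) (not_le.2 h)
  -- Negative values occur only over the closed ball, so a lower semicontinuous function attains its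
  -- minimum on the compact cylinder, and that minimum is global on the slab. It is not at the
  -- terminal time; there the time derivative and all second derivatives are nonnegative, against
  -- the strict inequality.
  obtain ⟨⟨z₁, t₁⟩, ⟨-, ht1⟩, hmin⟩ := LowerSemicontinuousOn.exists_isMinOn
    (s := Metric.closedBall (0 : E p) R ×ˢ Set.Icc a b) ⟨(z, t), hzR z t ht hneg, ht⟩
    ((isCompact_closedBall _ _).prod isCompact_Icc)
    (hlsc.mono (Set.prod_mono (Set.subset_univ _) le_rfl))
  have hmin' : ∀ z', ∀ t' ∈ Set.Icc a b, z' ∈ Metric.closedBall (0 : E p) R →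
      Ψ z₁ t₁ ≤ Ψ z' t' := fun z' t' ht' hz' => by
    simpa [Function.uncurry] using isMinOn_iff.1 hmin (z', t') (Set.mk_mem_prod hz' ht')
  have hneg1 : Ψ z₁ t₁ < 0 := (hmin' z t ht (hzR z t ht hneg)).trans_lt hneg
  have hglob : ∀ z', ∀ t' ∈ Set.Icc a b, Ψ z₁ t₁ ≤ Ψ z' t' := by
    intro z' t' ht'
    by_cases h : Ψ z' t' < 0
    · exact hmin' z' t' ht' (hzR z' t' ht' h)
    · exact hneg1.le.trans (not_lt.1 h)
  have ht1b : t₁ < b := by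
    refine lt_of_le_of_ne ht1.2 ?_
    rintro rfl
    exact absurd (hend z₁) (not_le.2 hneg1)
  obtain ⟨d, D, hd, hD, hlt⟩ := hpde z₁ t₁ ⟨ht1.1, ht1b⟩
  have hd0 : 0 ≤ d := HasDerivAt.nonneg_of_isMinOn_Ico hd ht1b
    fun s hs => hglob z₁ s ⟨ht1.1.trans hs.1, hs.2.le⟩
  have hD0 : ∀ i, 0 ≤ D i := fun i => (hD i).nonneg_of_isLocalMin
    (Eventually.of_forall fun s => by
      simp only [zero_smul, add_zero]
      exact hglob _ t₁ ht1)
  have := Finset.sum_nonneg fun i (_ : i ∈ Finset.univ) => hD0 i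
  linarith

/-! ### Normal marginals -/

section Marginal

variable {π : Measure (E p)} {b : ℝ}

lemma measurable_ofReal_normalDensity (v : ℝ) (z : E p) :
    Measurable fun μ => ENNReal.ofReal (normalDensity v μ z) :=
  (measurable_normalDensity v measurable_id measurable_const).ennreal_ofReal

lemma normalDensity_le_mul {v : ℝ} (hv : 0 < v) (hvb : v ≤ b) (μ z : E p) :
    normalDensity v μ z ≤
      (2 * Real.pi * v) ^ (-(p : ℝ) / 2) / (2 * Real.pi * b) ^ (-(p : ℝ) / 2) *
        normalDensity b μ z := by
  have hb : 0 < b := hv.trans_le hvb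
  have hπ := Real.pi_pos
  have h : (2 * Real.pi * b) ^ (-(p : ℝ) / 2) ≠ 0 := by positivity
  unfold normalDensity
  rw [← mul_assoc, div_mul_cancel₀ _ h]
  refine mul_le_mul_of_nonneg_left (Real.exp_le_exp.2 ?_) (by positivity)
  rw [neg_div, neg_div]
  gcongr

lemma marginal_ne_top (hfin : ∀ z, marginal π b z ≠ ∞) {v : ℝ} (hv : 0 < v) (hvb : v ≤ b)
    (z : E p) : marginal π v z ≠ ∞ := by
  have hπ := Real.pi_pos
  have hb : 0 < b := hv.trans_le hvb
  refine ne_top_of_le_ne_top (b := ENNReal.ofReal ((2 * Real.pi * v) ^ (-(p : ℝ) / 2) /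
    (2 * Real.pi * b) ^ (-(p : ℝ) / 2)) * marginal π b z)
    (ENNReal.mul_ne_top ENNReal.ofReal_ne_top (hfin z)) ?_
  unfold marginal
  rw [← lintegral_const_mul _ (measurable_ofReal_normalDensity b z)]
  refine lintegral_mono fun μ => ?_
  rw [← ENNReal.ofReal_mul (by positivity)]
  exact ENNReal.ofReal_le_ofReal (normalDensity_le_mul hv hvb μ z)

lemma marginal_ne_zero (hπ : π ≠ 0) {v : ℝ} (hv : 0 < v) (z : E p) : marginal π v z ≠ 0 := by
  unfold marginal
  rw [Ne, lintegral_eq_zero_iff (measurable_ofReal_normalDensity v z)]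
  intro h
  apply hπ
  rw [← Measure.measure_univ_eq_zero, measure_eq_zero_iff_ae_notMem]
  filter_upwards [h] with μ hμ
  have : normalDensity v μ z ≤ 0 := by simpa using hμ
  exact absurd this (not_le.2 (normalDensity_pos hv μ z))

lemma integrable_normalDensity_prior {v : ℝ} {z : E p} (h : marginal π v z ≠ ∞) (hv : 0 < v) :
    Integrable (fun μ => normalDensity v μ z) π := by
  refine ⟨(measurable_normalDensity v measurable_id measurable_const).aestronglyMeasurable, ?_⟩
  rw [hasFiniteIntegral_iff_ofReal (ae_of_all _ fun μ => normalDensity_nonneg hv μ z)]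
  exact h.lt_top

lemma toReal_marginal {v : ℝ} (hv : 0 < v) (z : E p) :
    (marginal π v z).toReal = ∫ μ, normalDensity v μ z ∂π := by
  rw [integral_eq_lintegral_of_nonneg_ae (ae_of_all _ fun μ => normalDensity_nonneg hv μ z)
    (measurable_normalDensity v measurable_id measurable_const).aestronglyMeasurable]
  rfl

lemma toReal_marginal_pos (hπ : π ≠ 0) (hfin : ∀ z, marginal π b z ≠ ∞) {v : ℝ} (hv : 0 < v)
    (hvb : v ≤ b) (z : E p) : 0 < (marginal π v z).toReal :=
  ENNReal.toReal_pos (marginal_ne_zero hπ hv z) (marginal_ne_top hfin hv hvb z)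

/-- Weighting the prior by a strictly positive kernel gives a finite measure, and dividing by the
kernel recovers the prior. Tonelli's theorem becomes available for improper priors. -/
lemma sigmaFinite_of_marginal_ne_top {v : ℝ} (hv : 0 < v) {z : E p}
    (h : marginal π v z ≠ ∞) : SigmaFinite π := by
  have : IsFiniteMeasure (π.withDensity fun μ => ENNReal.ofReal (normalDensity v μ z)) :=
    isFiniteMeasure_withDensity h
  rw [← withDensity_inv_same (μ := π) (measurable_ofReal_normalDensity v z)
    (ae_of_all _ fun μ => by simpa using normalDensity_pos hv μ z)
    (ae_of_all _ fun μ => ENNReal.ofReal_ne_top)]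
  refine SigmaFinite.withDensity_of_ne_top (ae_of_all _ fun μ => ?_)
  simpa using normalDensity_pos hv μ z

/-- The logarithm of a normal marginal is bounded below by a quadratic function. -/
lemma exists_neg_le_log_marginal (hπ : π ≠ 0) (hfin : ∀ z, marginal π b z ≠ ∞) {a : ℝ}
    (ha : 0 < a) : ∃ C : ℝ, 0 ≤ C ∧ ∀ v ∈ Set.Icc a b, ∀ z : E p,
      -(C * (1 + ‖z‖ ^ 2)) ≤ Real.log (marginal π v z).toReal := by
  -- Some centred ball carries prior mass. For means in it the kernel is bounded below by a Gaussian
  -- in z, using v ≤ b in the prefactor and v ≥ a in the exponent.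
  obtain ⟨n, hn⟩ : ∃ n : ℕ, π (Metric.ball (0 : E p) n) ≠ 0 := by
    by_contra! h
    apply hπ
    rw [← Measure.measure_univ_eq_zero, ← Metric.iUnion_ball_nat (0 : E p)]
    exact measure_iUnion_null h
  set B := Metric.ball (0 : E p) n with hB
  by_cases hab : a ≤ b
  swap
  · exact ⟨0, le_rfl, fun v hv => absurd (hv.1.trans hv.2) hab⟩
  have hb : 0 < b := ha.trans_le hab
  have hpi := Real.pi_pos
  set L := (2 * Real.pi * b) ^ (-(p : ℝ) / 2) with hL
  have hL0 : 0 < L := by positivity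
  have hlow : ∀ v ∈ Set.Icc a b, ∀ z : E p, ∀ μ ∈ B,
      L * Real.exp (-(‖z‖ ^ 2 + n ^ 2) / a) ≤ normalDensity v μ z := by
    intro v hv z μ hμ
    have hv0 : 0 < v := ha.trans_le hv.1
    have h1 : L ≤ (2 * Real.pi * v) ^ (-(p : ℝ) / 2) := by
      apply Real.rpow_le_rpow_of_nonpos (by positivity)
      · have := hv.2
        gcongr
      · have : (0 : ℝ) ≤ p := Nat.cast_nonneg p
        linarith
    have hμn : ‖μ‖ < n := by simpa [hB] using hμ
    have h2 : ‖z - μ‖ ^ 2 ≤ 2 * (‖z‖ ^ 2 + n ^ 2) := by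
      have h3 : ‖z - μ‖ ≤ ‖z‖ + n := (norm_sub_le _ _).trans (by linarith)
      have := pow_le_pow_left₀ (norm_nonneg _) h3 2
      nlinarith [sq_nonneg (‖z‖ - n)]
    have h4 : ‖z - μ‖ ^ 2 / (2 * v) ≤ (‖z‖ ^ 2 + n ^ 2) / a := by
      rw [div_le_div_iff₀ (by positivity) ha]
      have := hv.1
      calc ‖z - μ‖ ^ 2 * a ≤ (2 * (‖z‖ ^ 2 + n ^ 2)) * v := by gcongr
        _ = _ := by ring
    unfold normalDensity
    refine mul_le_mul h1 (Real.exp_le_exp.2 ?_) (by positivity) (by positivity)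
    rw [neg_div, neg_div]
    exact neg_le_neg h4
  -- Any positive real below the mass of the ball will do, so the case of infinite mass need not be
  -- ruled out.
  obtain ⟨c, hc0, hc⟩ : ∃ c : ℝ, 0 < c ∧ ENNReal.ofReal c ≤ π B := by
    by_cases hBt : π B = ∞
    · exact ⟨1, one_pos, by simp [hBt]⟩
    · exact ⟨(π B).toReal, ENNReal.toReal_pos hn hBt, ENNReal.ofReal_toReal_le⟩
  refine ⟨|Real.log (L * c)| + n ^ 2 / a + 1 / a, by positivity, fun v hv z => ?_⟩
  have hv0 : 0 < v := ha.trans_le hv.1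
  have h5 : L * Real.exp (-(‖z‖ ^ 2 + n ^ 2) / a) * c ≤ (marginal π v z).toReal := by
    rw [← ENNReal.ofReal_le_iff_le_toReal (marginal_ne_top hfin hv0 hv.2 z),
      ENNReal.ofReal_mul (by positivity)]
    calc ENNReal.ofReal (L * Real.exp (-(‖z‖ ^ 2 + n ^ 2) / a)) * ENNReal.ofReal c
        ≤ ENNReal.ofReal (L * Real.exp (-(‖z‖ ^ 2 + n ^ 2) / a)) * π B := by gcongr
      _ = ∫⁻ _ in B, ENNReal.ofReal (L * Real.exp (-(‖z‖ ^ 2 + n ^ 2) / a)) ∂π := by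
          rw [setLIntegral_const]
      _ ≤ ∫⁻ μ in B, ENNReal.ofReal (normalDensity v μ z) ∂π :=
          setLIntegral_mono (measurable_ofReal_normalDensity v z) fun μ hμ =>
            ENNReal.ofReal_le_ofReal (hlow v hv z μ hμ)
      _ ≤ marginal π v z := setLIntegral_le_lintegral _ _
  have h6 := Real.log_le_log (by positivity) h5
  rw [mul_right_comm, Real.log_mul (by positivity) (by positivity), Real.log_exp] at h6
  have h7 := neg_abs_le (Real.log (L * c))
  have h8 : 0 ≤ |Real.log (L * c)| * ‖z‖ ^ 2 := by positivity
  have h9 : 0 ≤ n ^ 2 / a * ‖z‖ ^ 2 := by positivity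
  have h10 : -(‖z‖ ^ 2 + n ^ 2) / a = -(1 / a * ‖z‖ ^ 2) - n ^ 2 / a := by ring
  have h11 : 0 < 1 / a := by positivity
  nlinarith

/-- Fatou's lemma gives semicontinuity up to and including v = b, where the domination by a larger
variance used in the smoothing lemmas is unavailable. The minimum principle asks for no more. -/
lemma lowerSemicontinuousOn_log_marginal (hπ : π ≠ 0) (hfin : ∀ z, marginal π b z ≠ ∞) {a : ℝ}
    (ha : 0 < a) : LowerSemicontinuousOn
      (fun q : E p × ℝ => Real.log (marginal π q.2 q.1).toReal) (Set.univ ×ˢ Set.Icc a b) := by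
  rintro ⟨z, v⟩ ⟨-, hv⟩ y hy
  simp only at hy hv
  have hv0 : 0 < v := ha.trans_le hv.1
  have hpi := Real.pi_pos
  have hpos := toReal_marginal_pos hπ hfin hv0 hv.2 z
  rw [gt_iff_lt, Real.lt_log_iff_exp_lt hpos, ← ENNReal.ofReal_lt_iff_lt_toReal (Real.exp_pos _).le
    (marginal_ne_top hfin hv0 hv.2 z)] at hy
  have hcont : ∀ μ : E p, ContinuousAt (fun q : E p × ℝ => normalDensity q.2 μ q.1) (z, v) := by
    intro μ
    unfold normalDensity
    refine ContinuousAt.mul ?_ ?_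
    · exact ContinuousAt.rpow_const (by fun_prop) (Or.inl (by simp; positivity))
    · refine (ContinuousAt.div (by fun_prop) (by fun_prop) ?_).rexp
      simp; positivity
  have hfatou : marginal π v z ≤ liminf (fun q : E p × ℝ => marginal π q.2 q.1) (𝓝 (z, v)) := by
    refine le_trans (le_of_eq ?_) (lintegral_liminf_le
      (f := fun (q : E p × ℝ) μ => ENNReal.ofReal (normalDensity q.2 μ q.1))
      (fun q => measurable_ofReal_normalDensity q.2 q.1))
    unfold marginal
    congr 1 with μ
    exact ((ENNReal.tendsto_ofReal (hcont μ)).liminf_eq).symm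
  have hev := eventually_lt_of_lt_liminf (hy.trans_le hfatou)
  filter_upwards [nhdsWithin_le_nhds hev, self_mem_nhdsWithin] with q hq hqs
  have hq0 : 0 < q.2 := ha.trans_le hqs.2.1
  simp only [gt_iff_lt]
  rw [Real.lt_log_iff_exp_lt (toReal_marginal_pos hπ hfin hq0 hqs.2.2 q.1)]
  rwa [← ENNReal.ofReal_lt_iff_lt_toReal (Real.exp_pos _).le
    (marginal_ne_top hfin hq0 hqs.2.2 q.1)]

end Marginal

/-! ### Superharmonicity of the marginal and the backward heat equation for its logarithm -/

lemma ContDiff.hasSecondDerivAtZero {f : E p → ℝ} (hf : ContDiff ℝ 2 f) (z e : E p) :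
    HasSecondDerivAtZero (fun s => f (z + s • e)) (iteratedFDeriv ℝ 2 f z ![e, e]) := by
  have hline : ∀ s : ℝ, HasDerivAt (fun s : ℝ => z + s • e) e s := fun s => by
    simpa using ((hasDerivAt_id s).smul_const e).const_add z
  refine ⟨fun s => fderiv ℝ f (z + s • e) e, Eventually.of_forall fun s => ?_, ?_⟩
  · exact ((hf.differentiable (by norm_num)) _).hasFDerivAt.comp_hasDerivAt s (hline s)
  · have h1 : ContDiff ℝ 1 (fderiv ℝ f) := hf.fderiv_right (by norm_num)
    have h2 := ((h1.differentiable (by norm_num)) (z + (0 : ℝ) • e)).hasFDerivAt.comp_hasDerivAt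
      (0 : ℝ) (hline 0)
    have h3 := h2.clm_apply (hasDerivAt_const (0 : ℝ) e)
    rw [iteratedFDeriv_two_apply]
    simpa using h3

lemma laplacian_eq_sum_single (f : E p → ℝ) (z : E p) :
    Laplacian.laplacian f z = ∑ i, iteratedFDeriv ℝ 2 f z
      ![EuclideanSpace.single i (1 : ℝ), EuclideanSpace.single i (1 : ℝ)] := by
  rw [InnerProductSpace.laplacian_eq_iteratedFDeriv_orthonormalBasis f
    (EuclideanSpace.basisFun (Fin p) ℝ)]
  simp

/-- The number c is u'(0)/u(0). Sharing it between the two formulas is the point: with u = √m the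
squared-gradient terms of m = u² and of log u can be cancelled against each other. -/
lemma HasSecondDerivAtZero.log_and_sq {u : ℝ → ℝ} {d : ℝ} (hu : HasSecondDerivAtZero u d)
    (h0 : 0 < u 0) : ∃ c : ℝ,
      HasSecondDerivAtZero (fun s => Real.log (u s)) (d / u 0 - c ^ 2) ∧
      HasSecondDerivAtZero (fun s => u s ^ 2) (2 * u 0 * d + 2 * u 0 ^ 2 * c ^ 2) := by
  have hcont := hu.continuousAt
  obtain ⟨u', h1, h2⟩ := hu
  refine ⟨u' 0 / u 0, ⟨fun s => u' s / u s, ?_, ?_⟩, ⟨fun s => 2 * u s * u' s, ?_, ?_⟩⟩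
  · filter_upwards [h1, hcont.eventually_ne h0.ne'] with s hs hs0 using hs.log hs0
  · refine (h2.div h1.self_of_nhds h0.ne').congr_deriv ?_
    field_simp
  · filter_upwards [h1] with s hs
    refine (hs.pow 2).congr_deriv ?_
    simp
  · refine ((h1.self_of_nhds.const_mul 2).mul h2).congr_deriv ?_
    field_simp
    ring

/-- The heat equation replaces ∂_v m by ½Δm, and the left side becomes Δm/m − ½|∇ log m|², which
also equals 2Δ√m/√m. The first form settles the case of superharmonic m, the second that of
superharmonic √m. -/
lemma log_marginal_supersolution {π : Measure (E p)} {b : ℝ} (hπ : π ≠ 0)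
    (hfin : ∀ z, marginal π b z ≠ ∞) {v : ℝ} (hv : 0 < v) (hvb : v < b)
    (hsuper : Superharmonic (fun z => (marginal π v z).toReal) ∨
      Superharmonic (fun z => Real.sqrt (marginal π v z).toReal)) (z : E p) :
    ∃ (d : ℝ) (D : Fin p → ℝ),
      HasDerivAt (fun v => Real.log (marginal π v z).toReal) d v ∧
      (∀ i, HasSecondDerivAtZero (fun s => Real.log
        (marginal π v (z + s • EuclideanSpace.single i (1 : ℝ))).toReal) (D i)) ∧
      d + 1 / 2 * ∑ i, D i ≤ 0 := by
  have hb : 0 < b := hv.trans hvb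
  have hint : ∀ z, Integrable (fun μ => normalDensity b μ z) π := fun z =>
    integrable_normalDensity_prior (hfin z) hb
  have hM0 : 0 < (marginal π v z).toReal := toReal_marginal_pos hπ hfin hv hvb.le z
  have htime := hasDerivAt_smoothing_variance (φ := fun _ => (1 : ℝ)) (K := 1)
    measurable_const (by simp) (hint z) hv hvb
  have hline := fun i : Fin p => hasSecondDerivAtZero_smoothing (φ := fun _ => (1 : ℝ)) (K := 1)
    (z := z) measurable_const (by simp) hint hv hvb (e := EuclideanSpace.single i (1 : ℝ))
    (by simp)
  have hheat := sum_integral_smoothing (φ := fun _ => (1 : ℝ)) (K := 1)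
    measurable_const (by simp) (hint z) hv hvb
  simp only [one_mul] at htime hline hheat
  set T := ∫ μ, normalDensity v μ z * (‖z - μ‖ ^ 2 / (2 * v ^ 2) - p / (2 * v)) ∂π
  set D2 : Fin p → ℝ := fun i => ∫ μ, normalDensity v μ z *
    (inner ℝ (z - μ) (EuclideanSpace.single i (1 : ℝ)) ^ 2 / v ^ 2 - 1 / v) ∂π with hD2
  simp only [← toReal_marginal hv] at hline
  have htime' : HasDerivAt (fun v => (marginal π v z).toReal) T v := by
    refine htime.congr_of_eventuallyEq ?_
    filter_upwards [lt_mem_nhds hv] with w hw using toReal_marginal hw z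
  refine ⟨T / (marginal π v z).toReal, ?_⟩
  rcases hsuper with ⟨hC, hle⟩ | ⟨hC, hle⟩
  · choose c hc using fun i => (hline i).log_and_sq (by simpa using hM0)
    refine ⟨_, htime'.log hM0.ne', fun i => (hc i).1, ?_⟩
    have hl : ∑ i, D2 i ≤ 0 := by
      have h1 := hle z
      rw [laplacian_eq_sum_single] at h1
      refine le_of_eq_of_le (Finset.sum_congr rfl fun i _ => ?_) h1
      exact (hline i).unique (ContDiff.hasSecondDerivAtZero hC z _)
    simp only [zero_smul, add_zero, Finset.sum_sub_distrib, ← Finset.sum_div]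
    change T / _ + 1 / 2 * ((∑ i, D2 i) / _ - _) ≤ 0
    have hT : T = 1 / 2 * ∑ i, D2 i := by rw [hD2, hheat]; ring
    rw [hT]
    have h2 : (∑ i, D2 i) / (marginal π v z).toReal ≤ 0 := div_nonpos_of_nonpos_of_nonneg hl hM0.le
    have h3 := Finset.sum_nonneg fun i (_ : i ∈ Finset.univ) => sq_nonneg (c i)
    rw [mul_div_assoc]
    linarith
  · set u : E p → ℝ := fun z => Real.sqrt (marginal π v z).toReal with hu
    have hu0 : 0 < u z := Real.sqrt_pos.2 hM0
    have husq : ∀ z, u z ^ 2 = (marginal π v z).toReal := fun z =>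
      Real.sq_sqrt ENNReal.toReal_nonneg
    set du : Fin p → ℝ := fun i => iteratedFDeriv ℝ 2 u z
      ![EuclideanSpace.single i (1 : ℝ), EuclideanSpace.single i (1 : ℝ)] with hdu
    choose c hc1 hc2 using fun i : Fin p => (ContDiff.hasSecondDerivAtZero hC z
      (EuclideanSpace.single i (1 : ℝ))).log_and_sq (by simpa using hu0)
    refine ⟨fun i => 2 * (du i / u z - c i ^ 2), htime'.log hM0.ne', fun i => ?_, ?_⟩
    · have h1 := (hc1 i).const_mul 2
      simp only [zero_smul, add_zero] at h1
      convert h1 using 2 with s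
      rw [← husq, Real.log_pow]
      norm_num
    · have hD : ∀ i, D2 i = 2 * u z * du i + 2 * u z ^ 2 * c i ^ 2 := fun i => by
        have h2 := hc2 i
        change HasSecondDerivAtZero (fun s => u _ ^ 2) _ at h2
        simp only [husq] at h2
        refine (hline i).unique ?_
        simpa only [zero_smul, add_zero, husq] using h2
      have hlap : ∑ i, du i ≤ 0 := by
        have h1 := hle z
        rwa [laplacian_eq_sum_single] at h1
      have hT : T = 1 / 2 * ∑ i, D2 i := by rw [hD2, hheat]; ring
      rw [hT, Finset.sum_congr rfl fun i _ => hD i, ← husq, Finset.sum_add_distrib,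
        ← Finset.mul_sum, ← Finset.mul_sum, ← Finset.mul_sum, Finset.sum_sub_distrib,
        ← Finset.sum_div]
      -- The gradient terms from Δ(u²) and from 2Δ log u cancel exactly, leaving 2Δu/u.
      have h4 : 1 / 2 * (2 * u z * ∑ i, du i + 2 * u z ^ 2 * ∑ i, c i ^ 2) / u z ^ 2 +
          1 / 2 * (2 * ((∑ i, du i) / u z - ∑ i, c i ^ 2)) = 2 * ((∑ i, du i) / u z) := by
        field_simp
        ring
      rw [h4]
      have := div_nonpos_of_nonpos_of_nonneg hlap hu0.le
      linarith

/-! ### Normal averages of the log-marginal -/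

/-- The heat flow `E φ(z + √r N)` with `N` standard normal. -/
noncomputable def heatFlow (φ : E p → ℝ) (z : E p) (r : ℝ) : ℝ :=
  ∫ n, φ (z + Real.sqrt r • n) * normalDensity 1 0 n

lemma heatFlow_zero (φ : E p → ℝ) (z : E p) : heatFlow φ z 0 = φ z := by
  unfold heatFlow
  simp [integral_const_mul, integral_normalDensity]

/-- Scaling the noise by √r keeps the integrand continuous down to r = 0, where the kernel of
variance r degenerates; dominated convergence then covers the terminal time. -/
lemma continuous_heatFlow {φ : E p → ℝ} {K : ℝ} (hc : Continuous φ) (hφ : ∀ x, |φ x| ≤ K) :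
    Continuous fun q : E p × ℝ => heatFlow φ q.1 q.2 := by
  unfold heatFlow
  refine continuous_of_dominated (bound := fun n => K * normalDensity 1 0 n) (fun q => ?_)
    (fun q => ae_of_all _ fun n => ?_) ((integrable_normalDensity one_pos 0).const_mul K)
    (ae_of_all _ fun n => by fun_prop)
  · exact Measurable.aestronglyMeasurable (Measurable.mul (by fun_prop)
      (measurable_normalDensity 1 measurable_const measurable_id))
  · rw [norm_mul, Real.norm_eq_abs, Real.norm_of_nonneg (normalDensity_nonneg one_pos _ _)]
    exact mul_le_mul_of_nonneg_right (hφ _) (normalDensity_nonneg one_pos _ _)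

lemma abs_heatFlow_le {φ : E p → ℝ} {K : ℝ} (hφ : ∀ x, |φ x| ≤ K) (z : E p) (r : ℝ) :
    |heatFlow φ z r| ≤ K := by
  unfold heatFlow
  have h := norm_integral_le_of_norm_le ((integrable_normalDensity one_pos (0 : E p)).const_mul K)
    (f := fun n => φ (z + Real.sqrt r • n) * normalDensity 1 0 n) (ae_of_all _ fun n => by
      rw [norm_mul, Real.norm_eq_abs, Real.norm_of_nonneg (normalDensity_nonneg one_pos _ _)]
      exact mul_le_mul_of_nonneg_right (hφ _) (normalDensity_nonneg one_pos _ _))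
  rwa [integral_const_mul, integral_normalDensity one_pos, mul_one] at h

lemma heatFlow_eq_integral (φ : E p → ℝ) (z : E p) {r : ℝ} (hr : 0 < r) :
    heatFlow φ z r = ∫ y, φ y * normalDensity r y z := by
  have hs : 0 < Real.sqrt r := Real.sqrt_pos.2 hr
  have hpi := Real.pi_pos
  have h1 := Measure.integral_comp_smul volume
    (fun y : E p => φ (z + y) * normalDensity r (z + y) z) (Real.sqrt r)
  rw [integral_add_left_eq_self (fun y => φ y * normalDensity r y z) z] at h1
  have h2 : ∀ n : E p, φ (z + Real.sqrt r • n) * normalDensity 1 0 n =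
      r ^ ((p : ℝ) / 2) * (φ (z + Real.sqrt r • n) *
        normalDensity r (z + Real.sqrt r • n) z) := fun n => by
    have h3 : normalDensity 1 0 n = r ^ ((p : ℝ) / 2) *
        normalDensity r (z + Real.sqrt r • n) z := by
      unfold normalDensity
      have h4 : z - (z + Real.sqrt r • n) = -(Real.sqrt r • n) := by abel
      rw [h4, norm_neg, norm_smul, mul_pow, Real.norm_of_nonneg hs.le, Real.sq_sqrt hr.le,
        Real.mul_rpow (by positivity) hr.le, neg_div (2 : ℝ) (p : ℝ), Real.rpow_neg hr.le]
      have : r ^ ((p : ℝ) / 2) ≠ 0 := by positivity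
      field_simp
      simp
    rw [h3]; ring
  unfold heatFlow
  simp_rw [h2]
  rw [integral_const_mul, h1, finrank_euclideanSpace_fin, Real.sqrt_eq_rpow,
    ← Real.rpow_natCast, ← Real.rpow_mul hr.le, abs_of_nonneg (by positivity), smul_eq_mul,
    ← mul_assoc, show (1 : ℝ) / 2 * p = p / 2 by ring, mul_inv_cancel₀ (by positivity), one_mul]

/-- For positive remaining time the flow is a smoothing against Lebesgue measure, so it solves the
heat equation in r; substituting r = b − t reverses the sign of the time derivative. -/
lemma heatFlow_caloric {φ : E p → ℝ} {K : ℝ} (hm : Measurable φ) (hφ : ∀ x, |φ x| ≤ K)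
    (z : E p) {t b : ℝ} (htb : t < b) :
    ∃ (d : ℝ) (D : Fin p → ℝ), HasDerivAt (fun t => heatFlow φ z (b - t)) d t ∧
      (∀ i, HasSecondDerivAtZero (fun s =>
        heatFlow φ (z + s • EuclideanSpace.single i (1 : ℝ)) (b - t)) (D i)) ∧
      d + 1 / 2 * ∑ i, D i = 0 := by
  have hr : 0 < b - t := sub_pos.2 htb
  have hint : ∀ z : E p, Integrable (fun μ => normalDensity (2 * (b - t)) μ z) := fun z => by
    simpa only [normalDensity_comm] using integrable_normalDensity (by positivity) z
  have htime := hasDerivAt_smoothing_variance hm hφ (hint z) hr (by linarith)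
  have hline := fun i : Fin p => hasSecondDerivAtZero_smoothing (z := z) hm hφ hint hr
    (by linarith) (e := EuclideanSpace.single i (1 : ℝ)) (by simp)
  have hheat := sum_integral_smoothing hm hφ (hint z) hr (by linarith)
  simp only [← heatFlow_eq_integral φ _ hr] at hline
  have h1 : HasDerivAt (fun t => b - t) (-1) t := by
    simpa using (hasDerivAt_id t).const_sub b
  have h2 := htime.scomp t h1
  have h3 : (fun t => heatFlow φ z (b - t)) =ᶠ[𝓝 t]
      (fun v => ∫ μ, φ μ * normalDensity v μ z) ∘ fun t => b - t := by
    filter_upwards [gt_mem_nhds htb] with w hw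
    exact heatFlow_eq_integral φ z (sub_pos.2 hw)
  refine ⟨_, _, h2.congr_of_eventuallyEq h3, hline, ?_⟩
  rw [hheat, smul_eq_mul]
  ring

/-- A quartic barrier: a strict supersolution of the backward heat equation. -/
lemma barrier_supersolution (z : E p) (t : ℝ) :
    ∃ (d : ℝ) (D : Fin p → ℝ),
      HasDerivAt (fun t => Real.exp (-(5 + 2 * p) * t) * (1 + ‖z‖ ^ 2) ^ 2) d t ∧
      (∀ i, HasSecondDerivAtZero (fun s => Real.exp (-(5 + 2 * p) * t) *
        (1 + ‖z + s • EuclideanSpace.single i (1 : ℝ)‖ ^ 2) ^ 2) (D i)) ∧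
      d + 1 / 2 * ∑ i, D i < 0 := by
  set q := 1 + ‖z‖ ^ 2 with hq
  have hq1 : 1 ≤ q := by rw [hq]; nlinarith [sq_nonneg ‖z‖]
  have h1 : HasDerivAt (fun t : ℝ => Real.exp (-(5 + 2 * p) * t) * q ^ 2)
      (Real.exp (-(5 + 2 * p) * t) * (-(5 + 2 * p)) * q ^ 2) t := by
    simpa using (((hasDerivAt_id t).const_mul (-(5 + 2 * (p : ℝ)))).exp.mul_const (q ^ 2))
  have h2 : ∀ i : Fin p, HasSecondDerivAtZero
      (fun s => (1 + ‖z + s • EuclideanSpace.single i (1 : ℝ)‖ ^ 2) ^ 2)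
      (8 * inner ℝ z (EuclideanSpace.single i (1 : ℝ)) ^ 2 + 4 * q) := by
    intro i
    set c := inner ℝ z (EuclideanSpace.single i (1 : ℝ)) with hc
    have h3 : ∀ s : ℝ, 1 + ‖z + s • EuclideanSpace.single i (1 : ℝ)‖ ^ 2 =
        q + 2 * c * s + s ^ 2 := fun s => by
      rw [norm_add_sq_real, inner_smul_right, norm_smul, ← hc]
      simp [hq]
      ring
    have h4 : ∀ s : ℝ, HasDerivAt (fun s : ℝ => q + 2 * c * s + s ^ 2) (2 * c + 2 * s) s :=
      fun s => by
        refine ((((hasDerivAt_id s).const_mul (2 * c)).const_add q).add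
          (hasDerivAt_pow 2 s)).congr_deriv ?_
        simp
    simp only [h3]
    refine ⟨fun s => 2 * (q + 2 * c * s + s ^ 2) * (2 * c + 2 * s),
      Eventually.of_forall fun s => ?_, ?_⟩
    · refine ((h4 s).pow 2).congr_deriv ?_
      simp
    · have h5 : HasDerivAt (fun s : ℝ => 2 * c + 2 * s) 2 0 := by
        simpa using (((hasDerivAt_id (0 : ℝ)).const_mul 2).const_add (2 * c))
      refine (((h4 0).const_mul 2).mul h5).congr_deriv ?_
      simp
      ring
  refine ⟨_, _, h1, fun i => (h2 i).const_mul _, ?_⟩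
  rw [← Finset.mul_sum, Finset.sum_add_distrib, ← Finset.mul_sum, sum_inner_single_sq]
  simp only [Finset.sum_const, Finset.card_univ, Fintype.card_fin, nsmul_eq_mul]
  have he := Real.exp_pos (-(5 + 2 * (p : ℝ)) * t)
  -- Half the Laplacian of q² is 4‖z‖² + 2pq, which is at most (4 + 2p)q² since q ≥ 1; the rate 5 +
  -- 2p exceeds this strictly.
  have h6 : -(5 + 2 * p) * q ^ 2 + 1 / 2 * (8 * ‖z‖ ^ 2 + p * (4 * q)) < 0 := by
    have h7 : q ≤ q ^ 2 := by nlinarith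
    have h8 : ‖z‖ ^ 2 = q - 1 := by rw [hq]; ring
    have h9 : (p : ℝ) * q ≤ p * q ^ 2 := mul_le_mul_of_nonneg_left h7 (Nat.cast_nonneg p)
    rw [h8]
    nlinarith
  have := mul_neg_of_pos_of_neg he h6
  linarith

/-! ### Supermartingale inequality for the log-marginal -/

section LogMarginal

variable {π : Measure (E p)} {a b : ℝ}

/-- At the largest variance b no wider kernel is available for domination, so continuity is taken
from the C² part of the superharmonicity hypothesis. -/
lemma continuous_log_marginal (hπ : π ≠ 0) (hfin : ∀ z, marginal π b z ≠ ∞) (hb : 0 < b)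
    (hsuper : Superharmonic (fun z => (marginal π b z).toReal) ∨
      Superharmonic (fun z => Real.sqrt (marginal π b z).toReal)) :
    Continuous fun z => Real.log (marginal π b z).toReal := by
  have hpos := toReal_marginal_pos hπ hfin hb le_rfl
  refine Continuous.log ?_ fun z => (hpos z).ne'
  rcases hsuper with ⟨h, -⟩ | ⟨h, -⟩
  · exact h.continuous
  · have : Continuous fun z => Real.sqrt (marginal π b z).toReal ^ 2 := h.continuous.pow 2
    simpa only [Real.sq_sqrt ENNReal.toReal_nonneg] using this

/-- Truncated form of the supermartingale property of the log-marginal, with a barrier. -/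
lemma integral_min_le_log_marginal_add (hπ : π ≠ 0) (hfin : ∀ z, marginal π b z ≠ ∞)
    (ha : 0 < a) (hab : a < b)
    (hsuper : ∀ v ∈ Set.Icc a b, Superharmonic (fun z => (marginal π v z).toReal) ∨
      Superharmonic (fun z => Real.sqrt (marginal π v z).toReal))
    {C ε : ℝ} (hC : 0 ≤ C) (hε : 0 < ε)
    (hlow : ∀ v ∈ Set.Icc a b, ∀ z : E p,
      -(C * (1 + ‖z‖ ^ 2)) ≤ Real.log (marginal π v z).toReal)
    {κ K : ℝ} (hκ : κ = ε * Real.exp (-(5 + 2 * p) * b)) (hK : K = C ^ 2 / (4 * κ))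
    {G : E p → ℝ → ℝ} (hG : ∀ z t, G z t = Real.log (marginal π t z).toReal +
      ε * (Real.exp (-(5 + 2 * p) * t) * (1 + ‖z‖ ^ 2) ^ 2) + K) :
    (∀ z, ∀ t ∈ Set.Icc a b, 0 ≤ G z t) ∧ (Continuous fun z => G z b) ∧
      ∀ (w : E p) (n : ℕ), ∫ y, min (G y b) n * normalDensity (b - a) y w ≤ G w a := by
  have hb : 0 < b := ha.trans hab
  have hκ0 : 0 < κ := by rw [hκ]; positivity
  have hK0 : 0 ≤ K := by rw [hK]; positivity
  -- The constant κ is the smallest coefficient of the barrier over [a, b], reached at t = b; the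
  -- quartic then beats the quadratic lower bound on the log-marginal.
  have hGlow : ∀ z, ∀ t ∈ Set.Icc a b,
      κ * (1 + ‖z‖ ^ 2) ^ 2 - C * (1 + ‖z‖ ^ 2) + K ≤ G z t := by
    intro z t ht
    have h1 : κ ≤ ε * Real.exp (-(5 + 2 * p) * t) := by
      rw [hκ]
      refine mul_le_mul_of_nonneg_left (Real.exp_le_exp.2 ?_) hε.le
      have h5 : (0 : ℝ) ≤ 5 + 2 * p := by positivity
      nlinarith [ht.2]
    have h2 : κ * (1 + ‖z‖ ^ 2) ^ 2 ≤ ε * Real.exp (-(5 + 2 * p) * t) * (1 + ‖z‖ ^ 2) ^ 2 :=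
      mul_le_mul_of_nonneg_right h1 (by positivity)
    have h3 := hlow t ht z
    rw [hG]
    linarith
  -- K is chosen to complete the square in 1 + ‖z‖².
  have hGnn : ∀ z, ∀ t ∈ Set.Icc a b, 0 ≤ G z t := by
    intro z t ht
    refine le_trans ?_ (hGlow z t ht)
    have : κ * (1 + ‖z‖ ^ 2) ^ 2 - C * (1 + ‖z‖ ^ 2) + K =
        κ * ((1 + ‖z‖ ^ 2) - C / (2 * κ)) ^ 2 := by
      rw [hK]; field_simp; ring
    rw [this]
    positivity
  have hbmem : b ∈ Set.Icc a b := ⟨hab.le, le_rfl⟩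
  have hGc : Continuous fun z => G z b := by
    simp only [hG]
    have := continuous_log_marginal hπ hfin hb (hsuper b hbmem)
    fun_prop
  refine ⟨hGnn, hGc, fun w n => ?_⟩
  -- Truncation at n makes the terminal data bounded, so that their heat flow is defined and bounded
  -- by n.
  set φ : E p → ℝ := fun y => min (G y b) n with hφdef
  have hφc : Continuous φ := hGc.min continuous_const
  have hφ : ∀ x, |φ x| ≤ n := fun x => by
    rw [abs_of_nonneg (le_min (hGnn x b hbmem) (Nat.cast_nonneg n))]
    exact min_le_right _ _
  rw [← heatFlow_eq_integral φ w (sub_pos.2 hab), ← sub_nonneg]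
  -- Beyond this radius q = 1 + ‖z‖² satisfies κq ≥ C + n, hence κq² − Cq ≥ nq ≥ n, and G exceeds
  -- the heat flow.
  refine nonneg_of_supersolution (a := a) (b := b) (R := 1 + (C + n) / κ)
    (Ψ := fun z t => G z t - heatFlow φ z (b - t)) ?_ ?_ ?_ ?_ w ⟨le_rfl, hab.le⟩
  · have h1 := lowerSemicontinuousOn_log_marginal hπ hfin ha
    have h2 : Continuous fun q : E p × ℝ =>
        ε * (Real.exp (-(5 + 2 * p) * q.2) * (1 + ‖q.1‖ ^ 2) ^ 2) + K
          - heatFlow φ q.1 (b - q.2) := by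
      have h3 : Continuous fun q : E p × ℝ => heatFlow φ q.1 (b - q.2) :=
        (continuous_heatFlow hφc hφ).comp (by fun_prop : Continuous fun q : E p × ℝ =>
          (q.1, b - q.2))
      fun_prop
    have h4 := h1.add (h2.lowerSemicontinuous.lowerSemicontinuousOn (Set.univ ×ˢ Set.Icc a b))
    have h5 : (Function.uncurry fun z t => G z t - heatFlow φ z (b - t)) = fun q : E p × ℝ =>
        Real.log (marginal π q.2 q.1).toReal +
          (ε * (Real.exp (-(5 + 2 * p) * q.2) * (1 + ‖q.1‖ ^ 2) ^ 2) + K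
            - heatFlow φ q.1 (b - q.2)) := by
      funext q
      rw [Function.uncurry, hG]
      ring
    rw [h5]
    exact h4
  · intro z t ht hz
    have h1 := (abs_le.1 (abs_heatFlow_le hφ z (b - t))).2
    have h2 := hGlow z t ht
    set q := 1 + ‖z‖ ^ 2 with hq
    have hn : (0 : ℝ) ≤ n := Nat.cast_nonneg n
    have hR : 0 ≤ (C + n) / κ := by positivity
    have hq1 : 1 ≤ q := by rw [hq]; nlinarith [sq_nonneg ‖z‖]
    have hqR : (C + n) / κ ≤ q := by rw [hq]; nlinarith
    have h3 : C + n ≤ κ * q := by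
      rw [div_le_iff₀ hκ0] at hqR
      linarith
    have h4 : n ≤ κ * q ^ 2 - C * q := by
      have : (C + n) * q ≤ κ * q * q := mul_le_mul_of_nonneg_right h3 (by linarith)
      nlinarith
    linarith
  · intro z
    simp only [sub_self, heatFlow_zero, sub_nonneg]
    exact min_le_left _ _
  · intro z t ht
    obtain ⟨d1, D1, hd1, hD1, hs1⟩ := log_marginal_supersolution hπ hfin (ha.trans_le ht.1) ht.2
      (hsuper t ⟨ht.1, ht.2.le⟩) z
    obtain ⟨d2, D2, hd2, hD2, hs2⟩ := barrier_supersolution z t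
    obtain ⟨d3, D3, hd3, hD3, hs3⟩ := heatFlow_caloric hφc.measurable hφ z ht.2
    refine ⟨d1 + ε * d2 - d3, fun i => D1 i + ε * D2 i + (-1) * D3 i, ?_, fun i => ?_, ?_⟩
    · simp only [hG]
      exact ((hd1.add (hd2.const_mul ε)).add_const K).sub hd3
    · have h1 := (((hD1 i).add ((hD2 i).const_mul ε)).add_const K).add ((hD3 i).const_mul (-1))
      convert h1 using 2 with s
      rw [hG]
      ring
    · rw [Finset.sum_add_distrib, Finset.sum_add_distrib, ← Finset.mul_sum, ← Finset.mul_sum]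
      nlinarith

/-- Supermartingale property of the log-marginal along the heat flow. -/
theorem integral_log_marginal_le (hπ : π ≠ 0) (hfin : ∀ z, marginal π b z ≠ ∞)
    (ha : 0 < a) (hab : a < b)
    (hsuper : ∀ v ∈ Set.Icc a b, Superharmonic (fun z => (marginal π v z).toReal) ∨
      Superharmonic (fun z => Real.sqrt (marginal π v z).toReal)) (w : E p) :
    Integrable (fun y => normalDensity (b - a) w y * Real.log (marginal π b y).toReal) ∧
      ∫ y, normalDensity (b - a) w y * Real.log (marginal π b y).toReal ≤
        Real.log (marginal π a w).toReal := by
  obtain ⟨C, hC, hlow⟩ := exists_neg_le_log_marginal hπ hfin ha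
  have hr : 0 < b - a := sub_pos.2 hab
  set Q : ℝ → E p → ℝ := fun t z => Real.exp (-(5 + 2 * p) * t) * (1 + ‖z‖ ^ 2) ^ 2 with hQ
  have hQint : Integrable (fun y => normalDensity (b - a) w y * Q b y) :=
    integrable_quartic_mul_normalDensity hr w 0 (by fun_prop) (c := Real.exp (-(5 + 2 * p) * b))
      fun y => by rw [abs_of_nonneg (by positivity), sub_zero]
  -- With ε fixed, Fatou's lemma removes the truncation, and G ≥ 0 turns the bound into
  -- integrability. K blows up as ε → 0, but it is harmless: the kernel has mass one, so K cancels
  -- from both sides.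
  have key : ∀ ε : ℝ, 0 < ε → ∃ K : ℝ,
      Integrable (fun y => normalDensity (b - a) w y *
        (Real.log (marginal π b y).toReal + ε * Q b y + K)) ∧
      ∫ y, normalDensity (b - a) w y * (Real.log (marginal π b y).toReal + ε * Q b y + K) ≤
        Real.log (marginal π a w).toReal + ε * Q a w + K := by
    intro ε hε
    obtain ⟨hnn, hc, hle⟩ := integral_min_le_log_marginal_add hπ hfin ha hab hsuper hC hε hlow
      rfl rfl (fun z t => rfl)
    refine ⟨C ^ 2 / (4 * (ε * Real.exp (-(5 + 2 * p) * b))), ?_⟩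
    set G : E p → ℝ → ℝ := fun z t => Real.log (marginal π t z).toReal +
      ε * (Real.exp (-(5 + 2 * p) * t) * (1 + ‖z‖ ^ 2) ^ 2) +
        C ^ 2 / (4 * (ε * Real.exp (-(5 + 2 * p) * b))) with hG
    change Integrable (fun y => normalDensity (b - a) w y * G y b) ∧
      ∫ y, normalDensity (b - a) w y * G y b ≤ G w a
    have hbmem : b ∈ Set.Icc a b := ⟨hab.le, le_rfl⟩
    have hN := normalDensity_nonneg (p := p) hr
    have hnn' : ∀ y, 0 ≤ normalDensity (b - a) w y * G y b := fun y =>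
      mul_nonneg (hN w y) (hnn y b hbmem)
    have hGwa : 0 ≤ G w a := hnn w a ⟨le_rfl, hab.le⟩
    have hmeas : Measurable fun y => normalDensity (b - a) w y * G y b :=
      (measurable_normalDensity _ measurable_const measurable_id).mul hc.measurable
    have hmeasn : ∀ n : ℕ, Measurable fun y => normalDensity (b - a) w y * min (G y b) n :=
      fun n => (measurable_normalDensity _ measurable_const measurable_id).mul
        (hc.measurable.min measurable_const)
    have hlint : ∫⁻ y, ENNReal.ofReal (normalDensity (b - a) w y * G y b) ≤
        ENNReal.ofReal (G w a) := by
      have htend : ∀ y, Tendsto (fun n : ℕ =>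
          ENNReal.ofReal (normalDensity (b - a) w y * min (G y b) n)) atTop
          (𝓝 (ENNReal.ofReal (normalDensity (b - a) w y * G y b))) := fun y => by
        refine tendsto_const_nhds.congr' ?_
        filter_upwards [eventually_ge_atTop ⌈G y b⌉₊] with n hn
        rw [min_eq_left (Nat.ceil_le.1 hn)]
      calc ∫⁻ y, ENNReal.ofReal (normalDensity (b - a) w y * G y b)
          = ∫⁻ y, liminf (fun n : ℕ =>
            ENNReal.ofReal (normalDensity (b - a) w y * min (G y b) n)) atTop := by
            congr 1 with y
            exact (htend y).liminf_eq.symm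
        _ ≤ liminf (fun n : ℕ => ∫⁻ y,
            ENNReal.ofReal (normalDensity (b - a) w y * min (G y b) n)) atTop :=
            lintegral_liminf_le fun n => (hmeasn n).ennreal_ofReal
        _ ≤ ENNReal.ofReal (G w a) := by
            refine liminf_le_of_le ?_ fun c hc => ?_
            · isBoundedDefault
            · obtain ⟨n, hn⟩ := hc.exists
              refine hn.trans ?_
              have hint : Integrable (fun y => normalDensity (b - a) w y * min (G y b) n) := by
                refine ((integrable_normalDensity hr w).mul_const (n : ℝ)).mono'
                  (hmeasn n).aestronglyMeasurable (ae_of_all _ fun y => ?_)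
                rw [Real.norm_of_nonneg (mul_nonneg (hN w y)
                  (le_min (hnn y b hbmem) (Nat.cast_nonneg n)))]
                exact mul_le_mul_of_nonneg_left (min_le_right _ _) (hN w y)
              rw [← ofReal_integral_eq_lintegral_ofReal hint (ae_of_all _ fun y =>
                mul_nonneg (hN w y) (le_min (hnn y b hbmem) (Nat.cast_nonneg n)))]
              refine ENNReal.ofReal_le_ofReal (le_trans (le_of_eq ?_) (hle w n))
              congr 1 with y
              rw [normalDensity_comm, mul_comm]
    have hint : Integrable (fun y => normalDensity (b - a) w y * G y b) := by
      refine ⟨hmeas.aestronglyMeasurable, ?_⟩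
      rw [hasFiniteIntegral_iff_ofReal (ae_of_all _ hnn')]
      exact hlint.trans_lt ENNReal.ofReal_lt_top
    refine ⟨hint, ?_⟩
    rwa [← ofReal_integral_eq_lintegral_ofReal hint (ae_of_all _ hnn'),
      ENNReal.ofReal_le_ofReal_iff hGwa] at hlint
  have hNint := integrable_normalDensity hr w
  have hLint : Integrable
      (fun y => normalDensity (b - a) w y * Real.log (marginal π b y).toReal) := by
    obtain ⟨K, hK, -⟩ := key 1 one_pos
    refine ((hK.sub (hQint.const_mul 1)).sub (hNint.const_mul K)).congr (ae_of_all _ fun y => ?_)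
    simp only [Pi.sub_apply]
    ring
  refine ⟨hLint, ?_⟩
  have hQ0 : 0 < Q a w := by positivity
  refine le_of_forall_pos_le_add fun δ hδ => ?_
  -- This ε makes the barrier cost exactly δ at (w, a); on the left side the barrier is nonnegative
  -- and is dropped.
  obtain ⟨K, -, hK⟩ := key (δ / Q a w) (by positivity)
  have h1 : ∀ y, normalDensity (b - a) w y *
      (Real.log (marginal π b y).toReal + δ / Q a w * Q b y + K) =
      normalDensity (b - a) w y * Real.log (marginal π b y).toReal +
        (δ / Q a w * (normalDensity (b - a) w y * Q b y) + K * normalDensity (b - a) w y) :=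
    fun y => by ring
  have h2 : Integrable (fun y => δ / Q a w * (normalDensity (b - a) w y * Q b y) +
      K * normalDensity (b - a) w y) := (hQint.const_mul _).add (hNint.const_mul K)
  simp_rw [h1] at hK
  rw [integral_add hLint h2, integral_add (hQint.const_mul _) (hNint.const_mul K),
    integral_const_mul, integral_const_mul, integral_normalDensity hr, div_mul_cancel₀ _ hQ0.ne']
    at hK
  have h3 : 0 ≤ δ / Q a w * ∫ y, normalDensity (b - a) w y * Q b y :=
    mul_nonneg (by positivity) (integral_nonneg fun y => mul_nonneg (normalDensity_nonneg hr w y)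
      (by positivity))
  linarith

end LogMarginal

/-! ### Kullback--Leibler loss -/

lemma isProbabilityMeasure_withDensity_of_lintegral {f : E p → ℝ≥0∞} (h : ∫⁻ y, f y = 1) :
    IsProbabilityMeasure (volume.withDensity f) :=
  ⟨by rw [withDensity_apply _ MeasurableSet.univ, Measure.restrict_univ, h]⟩

lemma mul_log_div_add_sub_nonneg {A B : ℝ} (hA : 0 < A) (hB : 0 < B) :
    0 ≤ A * Real.log (A / B) + B - A := by
  have h1 := klFun_nonneg (div_pos hA hB).le
  rw [klFun_apply] at h1
  have h2 := mul_nonneg hB.le h1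
  have h3 : B * (A / B * Real.log (A / B) + 1 - A / B) = A * Real.log (A / B) + B - A := by
    field_simp
  rwa [h3] at h2

lemma isProbabilityMeasure_withDensity_normalDensity {v : ℝ} (hv : 0 < v) (μ : E p) :
    IsProbabilityMeasure (volume.withDensity fun y => ENNReal.ofReal (normalDensity v μ y)) :=
  isProbabilityMeasure_withDensity_of_lintegral (lintegral_normalDensity hv μ)

/-- A competitor may vanish on part of the space, so the loss is written through a Radon–Nikodym
derivative r instead of a quotient of densities. -/
lemma klLoss_eq_lintegral_of_ac {vy : ℝ} (hvy : 0 < vy) (μ : E p) {f : E p → ℝ≥0∞}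
    (hf : Measurable f) (hf1 : ∫⁻ y, f y = 1)
    (hac : (volume.withDensity fun y => ENNReal.ofReal (normalDensity vy μ y)) ≪
      volume.withDensity f) :
    ∃ r : E p → ℝ≥0∞, Measurable r ∧
      (∀ᵐ y, ENNReal.ofReal (normalDensity vy μ y) = f y * r y) ∧
      klLoss vy μ f = ∫⁻ y, f y * ENNReal.ofReal (klFun (r y).toReal) := by
  have h1 := isProbabilityMeasure_withDensity_normalDensity hvy μ
  have h2 : IsProbabilityMeasure (volume.withDensity f) :=
    isProbabilityMeasure_withDensity_of_lintegral hf1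
  have hN : Measurable fun y => ENNReal.ofReal (normalDensity vy μ y) :=
    (measurable_normalDensity vy measurable_const measurable_id).ennreal_ofReal
  set P := volume.withDensity fun y => ENNReal.ofReal (normalDensity vy μ y) with hP
  refine ⟨P.rnDeriv (volume.withDensity f), Measure.measurable_rnDeriv _ _, ?_, ?_⟩
  · have h3 := Measure.withDensity_rnDeriv_eq P (volume.withDensity f) hac
    rw [← withDensity_mul volume hf (Measure.measurable_rnDeriv _ _)] at h3
    exact ((withDensity_eq_iff_of_sigmaFinite hN.aemeasurable
      (hf.mul (Measure.measurable_rnDeriv _ _)).aemeasurable).1 (hP.symm.trans h3.symm))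
  · unfold klLoss
    rw [klDiv_eq_lintegral_klFun_of_ac hac, lintegral_withDensity_eq_lintegral_mul volume hf]
    · rfl
    · exact (measurable_klFun.comp (Measure.measurable_rnDeriv _ _).ennreal_toReal).ennreal_ofReal

/-- The correction g − p(·|μ) has integral zero and makes the integrand g · klFun(p/g), which is
pointwise nonnegative; the loss is then a Lebesgue integral with no integrability condition. -/
lemma klLoss_eq_lintegral {vy : ℝ} (hvy : 0 < vy) (μ : E p) {g : E p → ℝ}
    (hg : Measurable g) (hg0 : ∀ y, 0 < g y) (hg1 : ∫⁻ y, ENNReal.ofReal (g y) = 1) :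
    klLoss vy μ (fun y => ENNReal.ofReal (g y)) =
      ∫⁻ y, ENNReal.ofReal (normalDensity vy μ y * Real.log (normalDensity vy μ y / g y) +
        g y - normalDensity vy μ y) := by
  have hgm := hg.ennreal_ofReal
  have hac : (volume.withDensity fun y => ENNReal.ofReal (normalDensity vy μ y)) ≪
      volume.withDensity fun y => ENNReal.ofReal (g y) :=
    (withDensity_absolutelyContinuous _ _).trans
      (withDensity_absolutelyContinuous' hgm.aemeasurable
        (ae_of_all _ fun y => by simpa using hg0 y))
  obtain ⟨r, -, hr, hkl⟩ := klLoss_eq_lintegral_of_ac hvy μ hgm hg1 hac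
  rw [hkl]
  refine lintegral_congr_ae ?_
  filter_upwards [hr] with y hy
  have hy' : (r y).toReal = normalDensity vy μ y / g y := by
    have := congrArg ENNReal.toReal hy
    rw [ENNReal.toReal_mul, ENNReal.toReal_ofReal (normalDensity_nonneg hvy _ _),
      ENNReal.toReal_ofReal (hg0 y).le] at this
    rw [this, mul_div_cancel_left₀ _ (hg0 y).ne']
  rw [← ENNReal.ofReal_mul (hg0 y).le, hy', klFun_apply]
  congr 1
  have := (hg0 y).ne'
  field_simp

/-- Comparison of the losses of two densities through their likelihood ratio. -/
lemma klLoss_add_one_le {vy : ℝ} (hvy : 0 < vy) (μ : E p) {f : E p → ℝ≥0∞}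
    (hf : Measurable f) (hf1 : ∫⁻ y, f y = 1) {g : E p → ℝ}
    (hg : Measurable g) (hg0 : ∀ y, 0 < g y) (hg1 : ∫⁻ y, ENNReal.ofReal (g y) = 1) :
    klLoss vy μ (fun y => ENNReal.ofReal (g y)) + 1 ≤
      klLoss vy μ f +
        ∫⁻ y, ENNReal.ofReal (normalDensity vy μ y) * (f y / ENNReal.ofReal (g y)) := by
  by_cases hac : (volume.withDensity fun y => ENNReal.ofReal (normalDensity vy μ y)) ≪
      volume.withDensity f
  swap
  · rw [klLoss, klLoss, klDiv_of_not_ac hac, top_add]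
    exact le_top
  obtain ⟨r, hrm, hr, hkl⟩ := klLoss_eq_lintegral_of_ac hvy μ hf hf1 hac
  have hN : Measurable fun y => normalDensity vy μ y :=
    measurable_normalDensity vy measurable_const measurable_id
  have hfin : ∀ᵐ y, f y < ∞ := ae_lt_top hf (by rw [hf1]; exact ENNReal.one_ne_top)
  -- The added ones are the masses of f and of the normal density on the left and of g on the right.
  -- They make every integrand nonnegative, and the inequality reduces pointwise to log(f/g) ≤ f/g −
  -- 1.
  have key : klLoss vy μ (fun y => ENNReal.ofReal (g y)) + 1 + 1 ≤
      klLoss vy μ f +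
        (∫⁻ y, ENNReal.ofReal (normalDensity vy μ y) * (f y / ENNReal.ofReal (g y))) + 1 := by
    nth_rewrite 3 [← hg1]
    nth_rewrite 1 [← hf1]
    nth_rewrite 1 [← lintegral_normalDensity hvy μ]
    rw [klLoss_eq_lintegral hvy μ hg hg0 hg1, hkl, ← lintegral_add_right _ hf,
      ← lintegral_add_right _ hN.ennreal_ofReal,
      ← lintegral_add_right (μ := volume) (f := fun y => f y * ENNReal.ofReal (klFun (r y).toReal))
        (g := fun y => ENNReal.ofReal (normalDensity vy μ y) * (f y / ENNReal.ofReal (g y)))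
        (hN.ennreal_ofReal.mul (hf.div hg.ennreal_ofReal)),
      ← lintegral_add_right _ hg.ennreal_ofReal]
    refine lintegral_mono_ae ?_
    filter_upwards [hr, hfin] with y hy hfy
    have hP := normalDensity_pos hvy μ y
    have hq := hg0 y
    obtain ⟨F, hF0, hF⟩ : ∃ F : ℝ, 0 ≤ F ∧ f y = ENNReal.ofReal F :=
      ⟨(f y).toReal, ENNReal.toReal_nonneg, (ENNReal.ofReal_toReal hfy.ne).symm⟩
    have hPF : normalDensity vy μ y = F * (r y).toReal := by
      have := congrArg ENNReal.toReal hy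
      rwa [ENNReal.toReal_mul, ENNReal.toReal_ofReal hP.le, hF, ENNReal.toReal_ofReal hF0] at this
    set ρ := (r y).toReal with hρ
    set P := normalDensity vy μ y
    have hρ0 : 0 ≤ ρ := ENNReal.toReal_nonneg
    have hFpos : 0 < F := by
      rcases hF0.eq_or_lt with h | h
      · rw [← h, zero_mul] at hPF; exact absurd hPF hP.ne'
      · exact h
    have hρpos : 0 < ρ := by
      rcases hρ0.eq_or_lt with h | h
      · rw [← h, mul_zero] at hPF; exact absurd hPF hP.ne'
      · exact h
    have hk : 0 ≤ klFun ρ := klFun_nonneg hρ0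
    have h0 := mul_log_div_add_sub_nonneg hP hq
    rw [hF, ← ENNReal.ofReal_div_of_pos hq, ← ENNReal.ofReal_mul hP.le, ← ENNReal.ofReal_mul hF0,
      ← ENNReal.ofReal_add h0 hF0, ← ENNReal.ofReal_add (by positivity) hP.le,
      ← ENNReal.ofReal_add (by positivity) (by positivity),
      ← ENNReal.ofReal_add (by positivity) hq.le]
    refine ENNReal.ofReal_le_ofReal ?_
    have h5 := Real.log_le_sub_one_of_pos (div_pos hFpos hq)
    have h6 : Real.log (P / g y) = Real.log ρ + Real.log (F / g y) := by
      rw [← Real.log_mul hρpos.ne' (by positivity), hPF]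
      congr 1
      field_simp
    have h7 : P * Real.log (F / g y) ≤ P * (F / g y - 1) := mul_le_mul_of_nonneg_left h5 hP.le
    have h8 : F * klFun ρ = P * Real.log ρ + F - P := by
      rw [klFun_apply, hPF]; ring
    rw [h8, h6]
    linarith
  exact (ENNReal.add_le_add_iff_right ENNReal.one_ne_top).1 key

lemma log_normalDensity_div {s t : ℝ} (hs : 0 < s) (ht : 0 < t) (μ m y : E p) :
    Real.log (normalDensity t μ y / normalDensity s m y) =
      p / 2 * Real.log (s / t) - 1 / (2 * t) * ‖y - μ‖ ^ 2 + 1 / (2 * s) * ‖y - m‖ ^ 2 := by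
  have hpi := Real.pi_pos
  rw [Real.log_div (normalDensity_pos ht _ _).ne' (normalDensity_pos hs _ _).ne']
  unfold normalDensity
  rw [Real.log_mul (by positivity) (by positivity), Real.log_mul (by positivity) (by positivity),
    Real.log_exp, Real.log_exp, Real.log_rpow (by positivity), Real.log_rpow (by positivity),
    Real.log_mul (by positivity) ht.ne', Real.log_mul (by positivity) hs.ne',
    Real.log_div hs.ne' ht.ne']
  ring

/-- The Kullback--Leibler loss between two isotropic normal densities. -/
lemma klLoss_normalDensity {s t : ℝ} (hs : 0 < s) (ht : 0 < t) (μ m : E p) :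
    klLoss t μ (fun y => ENNReal.ofReal (normalDensity s m y)) =
      ENNReal.ofReal (p / 2 * Real.log (s / t) - p / 2 + (p * t + ‖μ - m‖ ^ 2) / (2 * s)) := by
  have hN := integrable_normalDensity ht μ
  have h1 : ∀ y, normalDensity t μ y * Real.log (normalDensity t μ y / normalDensity s m y) +
      normalDensity s m y - normalDensity t μ y =
      p / 2 * Real.log (s / t) * normalDensity t μ y
        - 1 / (2 * t) * (normalDensity t μ y * ‖y - μ‖ ^ 2)
        + 1 / (2 * s) * (normalDensity t μ y * ‖y - m‖ ^ 2)
        + normalDensity s m y - normalDensity t μ y := fun y => by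
    rw [log_normalDensity_div hs ht]; ring
  have i1 : Integrable (fun y => p / 2 * Real.log (s / t) * normalDensity t μ y) :=
    hN.const_mul _
  have i2 : Integrable (fun y => 1 / (2 * t) * (normalDensity t μ y * ‖y - μ‖ ^ 2)) :=
    (integrable_normalDensity_mul_norm_sub_sq ht μ μ).const_mul _
  have i3 : Integrable (fun y => 1 / (2 * s) * (normalDensity t μ y * ‖y - m‖ ^ 2)) :=
    (integrable_normalDensity_mul_norm_sub_sq ht μ m).const_mul _
  have i4 := integrable_normalDensity hs m
  have j2 : Integrable (fun y => p / 2 * Real.log (s / t) * normalDensity t μ y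
      - 1 / (2 * t) * (normalDensity t μ y * ‖y - μ‖ ^ 2)) := i1.sub i2
  have j3 : Integrable (fun y => p / 2 * Real.log (s / t) * normalDensity t μ y
      - 1 / (2 * t) * (normalDensity t μ y * ‖y - μ‖ ^ 2)
      + 1 / (2 * s) * (normalDensity t μ y * ‖y - m‖ ^ 2)) := j2.add i3
  have j4 : Integrable (fun y => p / 2 * Real.log (s / t) * normalDensity t μ y
      - 1 / (2 * t) * (normalDensity t μ y * ‖y - μ‖ ^ 2)
      + 1 / (2 * s) * (normalDensity t μ y * ‖y - m‖ ^ 2) + normalDensity s m y) := j3.add i4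
  have hpos : ∀ y, 0 ≤ normalDensity t μ y *
      Real.log (normalDensity t μ y / normalDensity s m y) +
      normalDensity s m y - normalDensity t μ y := fun y =>
    mul_log_div_add_sub_nonneg (normalDensity_pos ht μ y) (normalDensity_pos hs m y)
  rw [klLoss_eq_lintegral (g := normalDensity s m) ht μ
      (measurable_normalDensity s measurable_const measurable_id)
    (normalDensity_pos hs m) (lintegral_normalDensity hs m),
    ← ofReal_integral_eq_lintegral_ofReal _ (ae_of_all _ hpos)]
  · congr 1
    simp_rw [h1]
    rw [integral_sub j4 hN, integral_add j3 i4, integral_add j2 i3, integral_sub i1 i2, integral_const_mul, integral_const_mul,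
      integral_const_mul, integral_normalDensity ht, integral_normalDensity hs,
      integral_normalDensity_mul_norm_sub_sq ht, integral_normalDensity_mul_norm_sub_sq ht]
    simp
    field_simp
  · simp_rw [h1]
    exact j4.sub hN

/-! ### The Bayes predictive density -/

section Bayes

variable {π : Measure (E p)} {vx vy : ℝ}

/-- The uniform-prior predictive density appears as a factor, so the risk comparison involves the
prior only through the ratio of marginals at W and at x. -/
lemma bayesDensity_eq (hvx : 0 < vx) (hvy : 0 < vy) (x y : E p) :
    bayesDensity π vx vy x y = (marginal π vx x)⁻¹ * (ENNReal.ofReal (normalDensity (vx + vy) x y) *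
      marginal π (vx * vy / (vx + vy)) ((vx + vy)⁻¹ • (vy • x + vx • y))) := by
  unfold bayesDensity posterior
  rw [lintegral_smul_measure, smul_eq_mul,
    lintegral_withDensity_eq_lintegral_mul π (measurable_ofReal_normalDensity vx x)
      (measurable_ofReal_normalDensity vy y)]
  congr 1
  unfold marginal
  rw [← lintegral_const_mul _ (measurable_ofReal_normalDensity _ _)]
  congr 1 with μ
  rw [Pi.mul_apply, ← ENNReal.ofReal_mul (normalDensity_nonneg hvx _ _),
    normalDensity_mul_normalDensity hvx hvy,
    ENNReal.ofReal_mul (normalDensity_nonneg (by positivity) _ _)]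

lemma measurable_marginal [SFinite π] (v : ℝ) : Measurable fun z => marginal π v z := by
  unfold marginal
  exact Measurable.lintegral_prod_right'
    (f := fun q : E p × E p => ENNReal.ofReal (normalDensity v q.2 q.1))
    (measurable_normalDensity v measurable_snd measurable_fst).ennreal_ofReal

lemma isPredictiveDensity_bayesDensity (hvx : 0 < vx) (hvy : 0 < vy) (hπ : π ≠ 0)
    (hfin : ∀ z, marginal π vx z ≠ ∞) : IsPredictiveDensity (bayesDensity π vx vy) := by
  have := sigmaFinite_of_marginal_ne_top hvx (hfin 0)
  constructor
  · have : Function.uncurry (bayesDensity π vx vy) = fun q : E p × E p =>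
        (marginal π vx q.1)⁻¹ * (ENNReal.ofReal (normalDensity (vx + vy) q.1 q.2) *
      marginal π (vx * vy / (vx + vy)) ((vx + vy)⁻¹ • (vy • q.1 + vx • q.2))) := by
      funext q
      exact bayesDensity_eq hvx hvy q.1 q.2
    rw [this]
    refine ((measurable_marginal vx).comp measurable_fst).inv.mul
      ((measurable_normalDensity _ measurable_fst measurable_snd).ennreal_ofReal.mul
        ((measurable_marginal _).comp ?_))
    fun_prop
  · intro x
    unfold bayesDensity posterior
    rw [lintegral_lintegral_swap]
    · simp_rw [lintegral_normalDensity hvy]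
      rw [lintegral_one, Measure.smul_apply, withDensity_apply _ MeasurableSet.univ,
        Measure.restrict_univ, smul_eq_mul]
      exact ENNReal.inv_mul_cancel (marginal_ne_zero hπ hvx x) (hfin x)
    · exact (measurable_normalDensity vy measurable_snd
        measurable_fst).ennreal_ofReal.aemeasurable

end Bayes

/-! ### Lower bound for the maximal risk of a predictive density estimator -/

lemma lintegral_normalDensity_mul_const {v : ℝ} (hv : 0 < v) (μ : E p) (K : ℝ≥0∞) :
    ∫⁻ z, ENNReal.ofReal (normalDensity v μ z) * K = K := by
  rw [lintegral_mul_const _ (measurable_normalDensity v measurable_const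
    measurable_id').ennreal_ofReal, lintegral_normalDensity hv, one_mul]

lemma ofReal_integral_le_lintegral {α : Type*} [MeasurableSpace α] {m : Measure α} {f : α → ℝ}
    (hf : Integrable f m) : ENNReal.ofReal (∫ x, f x ∂m) ≤ ∫⁻ x, ENNReal.ofReal (f x) ∂m := by
  have h1 : ∫ x, f x ∂m ≤ ∫ x, max (f x) 0 ∂m :=
    integral_mono hf hf.pos_part fun x => le_max_left _ _
  refine (ENNReal.ofReal_le_ofReal h1).trans ?_
  rw [ofReal_integral_eq_lintegral_ofReal hf.pos_part (ae_of_all _ fun x => le_max_right _ _)]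
  refine lintegral_mono fun x => ?_
  simp

/-- Risk bound for the linear normal predictive density `N(c x, s I)`. -/
lemma ofReal_le_klRisk_normalDensity {vx vy s c : ℝ} (hvx : 0 < vx) (hvy : 0 < vy) (hs : 0 < s)
    (hc : 0 < c) (μ : E p) :
    ENNReal.ofReal (p / 2 * Real.log (s / vy) - p / 2 + (p * vy + c ^ 2 * (p * vx)) / (2 * s)) ≤
      klRisk vx vy μ (fun x y => ENNReal.ofReal (normalDensity s (c • x) y)) := by
  unfold klRisk
  set D0 := p / 2 * Real.log (s / vy) - p / 2 + p * vy / (2 * s) with hD0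
  have hN := integrable_normalDensity hvx μ
  have h1 : ∀ x : E p, ENNReal.ofReal (normalDensity vx μ x) *
      klLoss vy μ (fun y => ENNReal.ofReal (normalDensity s (c • x) y)) =
      ENNReal.ofReal (D0 * normalDensity vx μ x +
        c ^ 2 / (2 * s) * (normalDensity vx μ x * ‖x - c⁻¹ • μ‖ ^ 2)) := fun x => by
    rw [klLoss_normalDensity hs hvy, ← ENNReal.ofReal_mul (normalDensity_nonneg hvx _ _)]
    have h2 : μ - c • x = -(c • (x - c⁻¹ • μ)) := by
      rw [smul_sub, smul_smul, mul_inv_cancel₀ hc.ne', one_smul]; abel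
    rw [h2, norm_neg, norm_smul, mul_pow, Real.norm_of_nonneg hc.le, hD0]
    congr 1
    ring
  simp_rw [h1]
  have hi := integrable_normalDensity_mul_norm_sub_sq hvx μ (c⁻¹ • μ)
  refine le_trans (ENNReal.ofReal_le_ofReal ?_)
    (ofReal_integral_le_lintegral ((hN.const_mul D0).add (hi.const_mul (c ^ 2 / (2 * s)))))
  rw [integral_add (hN.const_mul D0) (hi.const_mul _), integral_const_mul, integral_const_mul,
    integral_normalDensity hvx, integral_normalDensity_mul_norm_sub_sq hvx]
  -- This is the squared bias of cx, up to a factor. Discarding it leaves a bound that is the same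
  -- for every μ and can be averaged over the prior at once.
  have h3 : 0 ≤ c ^ 2 / (2 * s) * ‖μ - c⁻¹ • μ‖ ^ 2 := by positivity
  rw [hD0, mul_one, mul_add, add_div]
  have h4 : c ^ 2 * (p * vx) / (2 * s) = c ^ 2 / (2 * s) * (p * vx) := by ring
  linarith

/-- The prior variance τ = c v_x/(1 − c) is the one with τ/(τ + v_x) = c, so the posterior is N(cx,
c v_x I). Integrating out μ leaves the marginal of x times the Bayes predictive density. -/
lemma lintegral_normalDensity_mul_three {vx vy c : ℝ} (hvx : 0 < vx) (hvy : 0 < vy) (hc : 0 < c)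
    (hc1 : c < 1) (x y : E p) :
    ∫⁻ μ, ENNReal.ofReal (normalDensity (c * vx / (1 - c)) 0 μ) *
      (ENNReal.ofReal (normalDensity vx μ x) * ENNReal.ofReal (normalDensity vy μ y)) =
    ENNReal.ofReal (normalDensity (vx / (1 - c)) x 0) *
      ENNReal.ofReal (normalDensity (vx * c + vy) (c • x) y) := by
  have h1c : 0 < 1 - c := sub_pos.2 hc1
  have hτ : 0 < c * vx / (1 - c) := by positivity
  have hsum : vx + c * vx / (1 - c) = vx / (1 - c) := by field_simp; ring
  have hprod : vx * (c * vx / (1 - c)) / (vx / (1 - c)) = vx * c := by field_simp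
  have hw : (vx / (1 - c))⁻¹ • ((c * vx / (1 - c)) • x + vx • (0 : E p)) = c • x := by
    rw [smul_zero, add_zero, smul_smul]
    congr 1
    field_simp
  have h1 : ∀ μ : E p, normalDensity (c * vx / (1 - c)) 0 μ *
      (normalDensity vx μ x * normalDensity vy μ y) =
      normalDensity (vx / (1 - c)) x 0 * normalDensity (vx * c + vy) (c • x) y *
        normalDensity (vx * c * vy / (vx * c + vy))
          ((vx * c + vy)⁻¹ • (vy • c • x + (vx * c) • y)) μ := fun μ => by
    rw [normalDensity_comm _ 0 μ, ← mul_assoc, mul_comm (normalDensity _ μ 0),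
      normalDensity_mul_normalDensity hvx hτ, hsum, hprod, hw, mul_assoc,
      normalDensity_mul_normalDensity (by positivity) hvy, ← mul_assoc,
      normalDensity_comm _ μ]
  have h2 : ∀ μ : E p, ENNReal.ofReal (normalDensity (c * vx / (1 - c)) 0 μ) *
      (ENNReal.ofReal (normalDensity vx μ x) * ENNReal.ofReal (normalDensity vy μ y)) =
      ENNReal.ofReal (normalDensity (vx * c * vy / (vx * c + vy))
          ((vx * c + vy)⁻¹ • (vy • c • x + (vx * c) • y)) μ) *
      (ENNReal.ofReal (normalDensity (vx / (1 - c)) x 0) *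
        ENNReal.ofReal (normalDensity (vx * c + vy) (c • x) y)) := fun μ => by
    have n1 := normalDensity_nonneg (p := p) hvx
    have n2 := normalDensity_nonneg (p := p) hτ
    have n3 : 0 ≤ normalDensity (vx / (1 - c)) x 0 := normalDensity_nonneg (by positivity) _ _
    have n4 : 0 ≤ normalDensity (vx * c + vy) (c • x) y :=
      normalDensity_nonneg (by positivity) _ _
    rw [← ENNReal.ofReal_mul (n1 _ _), ← ENNReal.ofReal_mul (n2 _ _), h1,
      ENNReal.ofReal_mul (mul_nonneg n3 n4), ENNReal.ofReal_mul n3, mul_comm]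
  simp_rw [h2]
  exact lintegral_normalDensity_mul_const (by positivity) _ _

lemma measurable_ofReal_normalDensity_comp {α : Type*} [MeasurableSpace α] (v : ℝ) {f h : α → E p}
    (hf : Measurable f) (hh : Measurable h) :
    Measurable fun a => ENNReal.ofReal (normalDensity v (f a) (h a)) :=
  (measurable_normalDensity v hf hh).ennreal_ofReal

/-- By Tonelli μ is integrated first, which produces the density that q is divided by; the quotient
cancels, and q(·|x) and the marginal of x both have mass one. -/
lemma lintegral_prior_likelihood_ratio {vx vy c : ℝ} (hvx : 0 < vx) (hvy : 0 < vy) (hc : 0 < c)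
    (hc1 : c < 1) {q : E p → E p → ℝ≥0∞} (hq : IsPredictiveDensity q) :
    ∫⁻ μ, ENNReal.ofReal (normalDensity (c * vx / (1 - c)) 0 μ) *
      ∫⁻ x, ENNReal.ofReal (normalDensity vx μ x) *
        ∫⁻ y, ENNReal.ofReal (normalDensity vy μ y) *
          (q x y / ENNReal.ofReal (normalDensity (vx * c + vy) (c • x) y)) = 1 := by
  have h1c : 0 < 1 - c := sub_pos.2 hc1
  set τ := c * vx / (1 - c) with hτdef
  set s := vx * c + vy with hsdef
  have hs : 0 < s := by positivity
  set ψ : E p → E p → ℝ≥0∞ := fun x y => q x y / ENNReal.ofReal (normalDensity s (c • x) y)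
    with hψ
  have hψm : Measurable fun z : E p × E p => ψ z.1 z.2 := hq.measurable.div
    (measurable_ofReal_normalDensity_comp s (measurable_fst.const_smul c) measurable_snd)
  change ∫⁻ μ, ENNReal.ofReal (normalDensity τ 0 μ) *
      ∫⁻ x, ENNReal.ofReal (normalDensity vx μ x) *
        ∫⁻ y, ENNReal.ofReal (normalDensity vy μ y) * ψ x y = 1
  set J : E p → ℝ≥0∞ := fun μ => ∫⁻ x, ENNReal.ofReal (normalDensity vx μ x) *
    ∫⁻ y, ENNReal.ofReal (normalDensity vy μ y) * ψ x y with hJ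
  have hJ' : ∀ μ, J μ = ∫⁻ x, ∫⁻ y, ENNReal.ofReal (normalDensity vx μ x) *
      ENNReal.ofReal (normalDensity vy μ y) * ψ x y := fun μ => by
    refine lintegral_congr fun x => ?_
    rw [← lintegral_const_mul' _ _ ENNReal.ofReal_ne_top]
    simp_rw [mul_assoc]
  have hm3 : Measurable fun z : (E p × E p) × E p => ENNReal.ofReal (normalDensity τ 0 z.1.1) *
      (ENNReal.ofReal (normalDensity vx z.1.1 z.1.2) *
        ENNReal.ofReal (normalDensity vy z.1.1 z.2) * ψ z.1.2 z.2) := by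
    have a1 : Measurable fun z : (E p × E p) × E p => z.1.1 := measurable_fst.fst
    have a2 : Measurable fun z : (E p × E p) × E p => z.1.2 := measurable_fst.snd
    exact (measurable_ofReal_normalDensity_comp τ measurable_const a1).mul (((measurable_ofReal_normalDensity_comp vx a1 a2).mul (measurable_ofReal_normalDensity_comp vy a1 measurable_snd)).mul
      (hψm.comp (a2.prodMk measurable_snd)))
  have hm2 : Measurable fun z : E p × E p => ∫⁻ y, ENNReal.ofReal (normalDensity τ 0 z.1) *
      (ENNReal.ofReal (normalDensity vx z.1 z.2) *
        ENNReal.ofReal (normalDensity vy z.1 y) * ψ z.2 y) := hm3.lintegral_prod_right'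
  calc ∫⁻ μ, ENNReal.ofReal (normalDensity τ 0 μ) * J μ
      = ∫⁻ μ, ∫⁻ x, ∫⁻ y, ENNReal.ofReal (normalDensity τ 0 μ) *
        (ENNReal.ofReal (normalDensity vx μ x) * ENNReal.ofReal (normalDensity vy μ y) *
          ψ x y) := by
        refine lintegral_congr fun μ => ?_
        rw [hJ', ← lintegral_const_mul' _ _ ENNReal.ofReal_ne_top]
        refine lintegral_congr fun x => ?_
        rw [← lintegral_const_mul' _ _ ENNReal.ofReal_ne_top]
    _ = ∫⁻ x, ∫⁻ μ, ∫⁻ y, ENNReal.ofReal (normalDensity τ 0 μ) *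
        (ENNReal.ofReal (normalDensity vx μ x) * ENNReal.ofReal (normalDensity vy μ y) *
          ψ x y) := lintegral_lintegral_swap hm2.aemeasurable
    _ = ∫⁻ x, ∫⁻ y, ∫⁻ μ, ENNReal.ofReal (normalDensity τ 0 μ) *
        (ENNReal.ofReal (normalDensity vx μ x) * ENNReal.ofReal (normalDensity vy μ y) *
          ψ x y) := by
        refine lintegral_congr fun x => lintegral_lintegral_swap ?_
        exact (hm3.comp (f := fun z : E p × E p => ((z.1, x), z.2)) (by fun_prop)).aemeasurable
    _ = ∫⁻ x, ∫⁻ y, ENNReal.ofReal (normalDensity (vx / (1 - c)) x 0) * q x y := by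
        refine lintegral_congr fun x => lintegral_congr fun y => ?_
        simp_rw [← mul_assoc _ _ (ψ x y)]
        rw [lintegral_mul_const, lintegral_normalDensity_mul_three hvx hvy hc hc1, mul_assoc]
        · congr 1
          exact ENNReal.mul_div_cancel (by simpa using normalDensity_pos hs (c • x) y) ENNReal.ofReal_ne_top
        · exact (measurable_ofReal_normalDensity_comp τ measurable_const measurable_id').mul
            ((measurable_ofReal_normalDensity_comp vx measurable_id' measurable_const).mul (measurable_ofReal_normalDensity_comp vy measurable_id' measurable_const))
    _ = ∫⁻ x, ENNReal.ofReal (normalDensity (vx / (1 - c)) x 0) := by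
        refine lintegral_congr fun x => ?_
        rw [lintegral_const_mul' _ _ ENNReal.ofReal_ne_top, hq.lintegral_eq_one, mul_one]
    _ = 1 := by
        simp_rw [normalDensity_comm _ _ (0 : E p)]
        exact lintegral_normalDensity (by positivity) 0

/-- The loss comparison is integrated over x, then over the normal prior. The likelihood-ratio term
averages to one and cancels the one on the other side, so no finiteness of the maximal risk is
needed. -/
lemma ofReal_le_iSup_klRisk {vx vy c : ℝ} (hvx : 0 < vx) (hvy : 0 < vy) (hc : 0 < c)
    (hc1 : c < 1) {q : E p → E p → ℝ≥0∞} (hq : IsPredictiveDensity q) :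
    ENNReal.ofReal (p / 2 * Real.log ((vx * c + vy) / vy) - p / 2 +
      (p * vy + c ^ 2 * (p * vx)) / (2 * (vx * c + vy))) ≤ ⨆ μ, klRisk vx vy μ q := by
  have h1c : 0 < 1 - c := sub_pos.2 hc1
  set τ := c * vx / (1 - c) with hτdef
  have hτ : 0 < τ := by positivity
  set s := vx * c + vy with hsdef
  have hs : 0 < s := by positivity
  set S := ⨆ μ, klRisk vx vy μ q
  set ρ := ENNReal.ofReal (p / 2 * Real.log (s / vy) - p / 2 +
    (p * vy + c ^ 2 * (p * vx)) / (2 * s))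
  set g : E p → E p → ℝ := fun x y => normalDensity s (c • x) y with hg
  have hgm : Measurable fun z : E p × E p => g z.1 z.2 :=
    measurable_normalDensity s (measurable_fst.const_smul c) measurable_snd
  have hgpos : ∀ x y, 0 < g x y := fun x y => normalDensity_pos hs _ _
  have hqm := hq.measurable
  set ψ : E p → E p → ℝ≥0∞ := fun x y => q x y / ENNReal.ofReal (g x y) with hψ
  have hψm : Measurable fun z : E p × E p => ψ z.1 z.2 := hqm.div hgm.ennreal_ofReal
  set J : E p → ℝ≥0∞ := fun μ => ∫⁻ x, ENNReal.ofReal (normalDensity vx μ x) *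
    ∫⁻ y, ENNReal.ofReal (normalDensity vy μ y) * ψ x y with hJ
  have hμ : ∀ μ, ρ + 1 ≤ S + J μ := fun μ => by
    have hIm : Measurable fun x => ENNReal.ofReal (normalDensity vx μ x) *
        ∫⁻ y, ENNReal.ofReal (normalDensity vy μ y) * ψ x y :=
      (measurable_ofReal_normalDensity_comp vx measurable_const measurable_id').mul
        (Measurable.lintegral_prod_right'
          (f := fun z : E p × E p => ENNReal.ofReal (normalDensity vy μ z.2) * ψ z.1 z.2)
          ((measurable_ofReal_normalDensity_comp vy measurable_const measurable_snd).mul hψm))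
    calc ρ + 1 ≤ klRisk vx vy μ (fun x y => ENNReal.ofReal (g x y)) +
          ∫⁻ x, ENNReal.ofReal (normalDensity vx μ x) := by
          rw [lintegral_normalDensity hvx]
          gcongr
          exact ofReal_le_klRisk_normalDensity hvx hvy hs hc μ
      _ = ∫⁻ x, ENNReal.ofReal (normalDensity vx μ x) *
          (klLoss vy μ (fun y => ENNReal.ofReal (g x y)) + 1) := by
          unfold klRisk
          rw [← lintegral_add_right _
            (measurable_ofReal_normalDensity_comp vx measurable_const measurable_id')]
          simp_rw [mul_add, mul_one]
      _ ≤ ∫⁻ x, (ENNReal.ofReal (normalDensity vx μ x) * klLoss vy μ (q x) +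
          ENNReal.ofReal (normalDensity vx μ x) *
            ∫⁻ y, ENNReal.ofReal (normalDensity vy μ y) * ψ x y) := by
          refine lintegral_mono fun x => ?_
          rw [← mul_add]
          refine mul_le_mul_of_nonneg_left ?_ zero_le
          exact klLoss_add_one_le hvy μ hqm.of_uncurry_left (hq.lintegral_eq_one x)
            (measurable_normalDensity s measurable_const measurable_id') (hgpos x)
            (lintegral_normalDensity hs _)
      _ = klRisk vx vy μ q + J μ := lintegral_add_right _ hIm
      _ ≤ S + J μ := by gcongr; exact le_iSup (fun μ => klRisk vx vy μ q) μ
  have hfin : ρ + 1 ≤ S + 1 := by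
    calc ρ + 1 = ∫⁻ μ, ENNReal.ofReal (normalDensity τ (0 : E p) μ) * (ρ + 1) :=
          (lintegral_normalDensity_mul_const hτ 0 _).symm
      _ ≤ ∫⁻ μ, (ENNReal.ofReal (normalDensity τ (0 : E p) μ) * S +
          ENNReal.ofReal (normalDensity τ (0 : E p) μ) * J μ) := by
          refine lintegral_mono fun μ => ?_
          rw [← mul_add]
          exact mul_le_mul_of_nonneg_left (hμ μ) zero_le
      _ = S + 1 := by
          rw [lintegral_add_left (f := fun μ => ENNReal.ofReal (normalDensity τ (0 : E p) μ) * S)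
              ((measurable_ofReal_normalDensity_comp τ measurable_const measurable_id').mul
                measurable_const),
            lintegral_prior_likelihood_ratio hvx hvy hc hc1 hq, lintegral_normalDensity_mul_const hτ]
  exact (ENNReal.add_le_add_iff_right ENNReal.one_ne_top).1 hfin

/-- The constant risk of the uniform-prior predictive density bounds every maximal risk below. -/
theorem ofReal_log_le_iSup_klRisk {vx vy : ℝ} (hvx : 0 < vx) (hvy : 0 < vy)
    {q : E p → E p → ℝ≥0∞} (hq : IsPredictiveDensity q) :
    ENNReal.ofReal (p / 2 * Real.log ((vx + vy) / vy)) ≤ ⨆ μ, klRisk vx vy μ q := by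
  -- Letting c → 1 corresponds to prior variance tending to infinity; at c = 1 the terms other than
  -- the logarithm cancel.
  have hcont : ContinuousAt (fun c : ℝ => ENNReal.ofReal (p / 2 * Real.log ((vx * c + vy) / vy) -
      p / 2 + (p * vy + c ^ 2 * (p * vx)) / (2 * (vx * c + vy)))) 1 := by
    refine ENNReal.continuous_ofReal.continuousAt.comp ?_
    have h1 : (vx * 1 + vy) / vy ≠ 0 := by positivity
    have h2 : 2 * (vx * 1 + vy) ≠ 0 := by positivity
    refine ContinuousAt.add (ContinuousAt.sub (ContinuousAt.mul continuousAt_const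
      (ContinuousAt.log (by fun_prop) h1)) continuousAt_const)
      (ContinuousAt.div (by fun_prop) (by fun_prop) h2)
  have h1 : ENNReal.ofReal (p / 2 * Real.log ((vx * 1 + vy) / vy) -
      p / 2 + (p * vy + 1 ^ 2 * (p * vx)) / (2 * (vx * 1 + vy))) =
      ENNReal.ofReal (p / 2 * Real.log ((vx + vy) / vy)) := by
    congr 1
    rw [mul_one]
    have : vx + vy ≠ 0 := by positivity
    field_simp
    ring
  have h2 : Tendsto (fun c : ℝ => ENNReal.ofReal (p / 2 * Real.log ((vx * c + vy) / vy) -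
      p / 2 + (p * vy + c ^ 2 * (p * vx)) / (2 * (vx * c + vy)))) (𝓝[<] 1)
      (𝓝 (ENNReal.ofReal (p / 2 * Real.log ((vx + vy) / vy)))) := by
    rw [← h1]
    exact hcont.tendsto.mono_left nhdsWithin_le_nhds
  refine le_of_tendsto h2 ?_
  filter_upwards [Ioo_mem_nhdsLT (zero_lt_one (α := ℝ))] with c hc
  exact ofReal_le_iSup_klRisk hvx hvy hc.1 hc.2 hq

/-! ### Upper bound for the risk of the Bayes predictive density -/

lemma lintegral_eq_mul_lintegral_smul_sub {k : ℝ} (hk : 0 < k) (c : E p) {h : E p → ℝ≥0∞}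
    (hh : Measurable h) : ∫⁻ y, h y = ENNReal.ofReal (k ^ p) * ∫⁻ w, h (k • w - c) := by
  have h1 : ∫⁻ w, h (k • w - c) = ∫⁻ y, h (y - c) ∂(Measure.map (k • ·) volume) :=
    (lintegral_map (f := fun y => h (y - c)) (hh.comp (measurable_id'.sub_const c))
      (measurable_const_smul k)).symm
  rw [h1, Measure.map_addHaar_smul volume hk.ne', lintegral_smul_measure, smul_eq_mul, ← mul_assoc,
    ← ENNReal.ofReal_mul (by positivity), finrank_euclideanSpace_fin,
    abs_of_nonneg (by positivity), mul_inv_cancel₀ (by positivity), ENNReal.ofReal_one, one_mul,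
    lintegral_sub_right_eq_self]

/-- The substitution (w, x) ↦ (x, kw − lx) has Jacobian k^p. It rewrites integrals over the two
observations as integrals over their weighted average w and the first observation. -/
lemma volume_eq_smul_map {k : ℝ} (hk : 0 < k) (l : ℝ) :
    (volume : Measure (E p × E p)) = ENNReal.ofReal (k ^ p) •
      Measure.map (fun q : E p × E p => (q.2, k • q.1 - l • q.2)) volume := by
  have hT : Measurable fun q : E p × E p => (q.2, k • q.1 - l • q.2) := by fun_prop
  refine Measure.ext_of_lintegral _ fun h hh => ?_
  rw [lintegral_smul_measure, lintegral_map hh hT, smul_eq_mul, Measure.volume_eq_prod,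
    lintegral_prod _ hh.aemeasurable, lintegral_prod_symm (fun q : E p × E p => h (q.2, k • q.1 - l • q.2))
      (hh.comp hT).aemeasurable,
    ← lintegral_const_mul' _ _ ENNReal.ofReal_ne_top]
  refine lintegral_congr fun x => ?_
  exact lintegral_eq_mul_lintegral_smul_sub hk (l • x) (hh.comp measurable_prodMk_left)

/-- A nonnegative density perturbed by conditional increments with nonpositive mean has no larger
integral. -/
lemma lintegral_le_of_conditional_mean_nonpos {A : E p × E p → ℝ} {N₁ F₁ F₂ : E p → ℝ}
    {N₂ : E p → E p → ℝ} (hA : Integrable A) (hN₁ : ∀ w, 0 ≤ N₁ w)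
    (hN₂ : ∀ w, Integrable (N₂ w)) (hN₂1 : ∀ w, ∫ x, N₂ w x = 1)
    (hF : ∀ w, Integrable fun x => N₂ w x * F₂ x) (hle : ∀ w, ∫ x, N₂ w x * F₂ x ≤ F₁ w)
    (hpos : ∀ w x, 0 ≤ A (w, x) + N₁ w * N₂ w x * (F₂ x - F₁ w)) :
    ∫⁻ w, ∫⁻ x, ENNReal.ofReal (A (w, x) + N₁ w * N₂ w x * (F₂ x - F₁ w)) ≤
      ENNReal.ofReal (∫ q, A q) := by
  rw [Measure.volume_eq_prod] at hA ⊢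
  have h1 : ∀ w x, A (w, x) + N₁ w * N₂ w x * (F₂ x - F₁ w) =
      A (w, x) + N₁ w * (N₂ w x * F₂ x - F₁ w * N₂ w x) := fun w x => by ring
  have hB : ∀ w, Integrable fun x => N₁ w * (N₂ w x * F₂ x - F₁ w * N₂ w x) := fun w =>
    ((hF w).sub ((hN₂ w).const_mul _)).const_mul _
  have hBle : ∀ w, ∫ x, N₁ w * (N₂ w x * F₂ x - F₁ w * N₂ w x) ≤ 0 := fun w => by
    rw [integral_const_mul, integral_sub (hF w) ((hN₂ w).const_mul _), integral_const_mul, hN₂1]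
    exact mul_nonpos_of_nonneg_of_nonpos (hN₁ w) (by linarith [hle w])
  -- Only A is jointly integrable; the increments are integrable in x for each fixed w.
  -- Nonnegativity of the sum lets the inequality be proved section by section and then integrated.
  have hkey : ∀ᵐ w, ∫⁻ x, ENNReal.ofReal (A (w, x) + N₁ w * N₂ w x * (F₂ x - F₁ w)) ≤
      ENNReal.ofReal (∫ x, A (w, x)) ∧ 0 ≤ ∫ x, A (w, x) := by
    filter_upwards [hA.prod_right_ae] with w hw
    have h2 : 0 ≤ ∫ x, (A (w, x) + N₁ w * (N₂ w x * F₂ x - F₁ w * N₂ w x)) :=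
      integral_nonneg fun x => by rw [Pi.zero_apply, ← h1]; exact hpos w x
    have h3 : ∫ x, (A (w, x) + N₁ w * (N₂ w x * F₂ x - F₁ w * N₂ w x)) ≤ ∫ x, A (w, x) := by
      rw [integral_add hw (hB w)]
      linarith [hBle w]
    refine ⟨?_, h2.trans h3⟩
    simp_rw [h1]
    have h4 : Integrable fun x => A (w, x) + N₁ w * (N₂ w x * F₂ x - F₁ w * N₂ w x) :=
      hw.add (hB w)
    rw [← ofReal_integral_eq_lintegral_ofReal h4 (ae_of_all _ fun x => by
      simp only [Pi.zero_apply]; rw [← h1]; exact hpos w x)]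
    exact ENNReal.ofReal_le_ofReal h3
  calc ∫⁻ w, ∫⁻ x, ENNReal.ofReal (A (w, x) + N₁ w * N₂ w x * (F₂ x - F₁ w))
      ≤ ∫⁻ w, ENNReal.ofReal (∫ x, A (w, x)) := lintegral_mono_ae (hkey.mono fun w h => h.1)
    _ = ENNReal.ofReal (∫ w, ∫ x, A (w, x)) :=
        (ofReal_integral_eq_lintegral_ofReal hA.integral_prod_left (hkey.mono fun w h => h.2)).symm
    _ = ENNReal.ofReal (∫ q, A q ∂(volume.prod volume)) := by rw [integral_prod _ hA]

lemma weighted_average_smul_sub {vx vy : ℝ} (hvx : 0 < vx) (hvy : 0 < vy) (w x : E p) :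
    (vx + vy)⁻¹ • (vy • x + vx • (((vx + vy) / vx) • w - (vy / vx) • x)) = w := by
  have h1 : vx * ((vx + vy) / vx) = vx + vy := by field_simp
  have h2 : vx * (vy / vx) = vy := by field_simp
  rw [smul_sub, smul_smul, smul_smul, h1, h2, add_sub_cancel, smul_smul,
    inv_mul_cancel₀ (by positivity), one_smul]

/-- The joint density of the observations, in terms of the precision-weighted average `w` and the
first observation. -/
lemma pow_mul_normalDensity_mul_normalDensity {vx vy : ℝ} (hvx : 0 < vx) (hvy : 0 < vy)
    (μ w x : E p) :
    ((vx + vy) / vx) ^ p * (normalDensity vx μ x *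
      normalDensity vy μ (((vx + vy) / vx) • w - (vy / vx) • x)) =
    normalDensity (vx * vy / (vx + vy)) μ w * normalDensity (vx - vx * vy / (vx + vy)) w x := by
  have hpi := Real.pi_pos
  set k := (vx + vy) / vx with hk
  have hk0 : 0 < k := by positivity
  -- Both sides are v_x²/(v_x + v_y): the conditional variance of X given W is that of Y − X
  -- rescaled by k.
  have hδ : vx - vx * vy / (vx + vy) = (vx + vy) / k ^ 2 := by rw [hk]; field_simp; ring
  have hw : (vx + vy)⁻¹ • (vy • x + vx • (k • w - (vy / vx) • x)) = w :=
    weighted_average_smul_sub hvx hvy w x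
  have hy : k • w - (vy / vx) • x - x = -(k • (x - w)) := by
    have : (vy / vx) • x + x = k • x := by
      rw [hk, add_div, div_self hvx.ne', add_comm (1 : ℝ), add_smul, one_smul]
    rw [sub_sub, this, smul_sub]; abel
  have hN : k ^ p * normalDensity (vx + vy) x (k • w - (vy / vx) • x) =
      normalDensity (vx - vx * vy / (vx + vy)) w x := by
    unfold normalDensity
    rw [hδ, hy, norm_neg, norm_smul, mul_pow, Real.norm_of_nonneg hk0.le,
      show 2 * Real.pi * ((vx + vy) / k ^ 2) = 2 * Real.pi * (vx + vy) / k ^ 2 by ring,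
      Real.div_rpow (by positivity) (by positivity), neg_div (2 : ℝ) (p : ℝ),
      Real.rpow_neg (x := k ^ 2) (by positivity), ← Real.rpow_natCast k 2, ← Real.rpow_mul hk0.le,
      show ((2 : ℕ) : ℝ) * ((p : ℝ) / 2) = p by push_cast; ring, Real.rpow_natCast,
      Real.rpow_natCast, div_inv_eq_mul, ← mul_assoc, mul_comm (k ^ p)]
    congr 2
    field_simp
  rw [normalDensity_mul_normalDensity hvx hvy, hw, ← mul_assoc, hN, mul_comm]

/-! ### Constant risk of the uniform-prior predictive density -/

section Product

variable {vx vy : ℝ}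

lemma integrable_normalDensity_prod (hvx : 0 < vx) (hvy : 0 < vy) (μ : E p) :
    Integrable fun q : E p × E p => normalDensity vx μ q.1 * normalDensity vy μ q.2 := by
  rw [Measure.volume_eq_prod]
  exact (integrable_normalDensity hvx μ).mul_prod (integrable_normalDensity hvy μ)

lemma integral_normalDensity_prod (hvx : 0 < vx) (hvy : 0 < vy) (μ : E p) :
    ∫ q : E p × E p, normalDensity vx μ q.1 * normalDensity vy μ q.2 = 1 := by
  rw [Measure.volume_eq_prod, integral_prod_mul, integral_normalDensity hvx,
    integral_normalDensity hvy, one_mul]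

/-- The expected log-likelihood ratio against the uniform-prior predictive density. -/
lemma integrable_and_integral_log_ratio (hvx : 0 < vx) (hvy : 0 < vy) (μ : E p) :
    Integrable (fun q : E p × E p => normalDensity vx μ q.1 * normalDensity vy μ q.2 *
      Real.log (normalDensity vy μ q.2 / normalDensity (vx + vy) q.1 q.2)) ∧
    ∫ q : E p × E p, normalDensity vx μ q.1 * normalDensity vy μ q.2 *
      Real.log (normalDensity vy μ q.2 / normalDensity (vx + vy) q.1 q.2) =
      p / 2 * Real.log ((vx + vy) / vy) := by
  have hs : 0 < vx + vy := by positivity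
  have nx := normalDensity_nonneg (p := p) hvx
  have ny := normalDensity_nonneg (p := p) hvy
  have i0 := integrable_normalDensity_prod hvx hvy μ
  have i1 : Integrable (fun q : E p × E p => normalDensity vx μ q.1 *
      (normalDensity vy μ q.2 * ‖q.2 - μ‖ ^ 2)) := by
    rw [Measure.volume_eq_prod]
    exact (integrable_normalDensity hvx μ).mul_prod
      (integrable_normalDensity_mul_norm_sub_sq hvy μ μ)
  have e1 : ∫ q : E p × E p, normalDensity vx μ q.1 *
      (normalDensity vy μ q.2 * ‖q.2 - μ‖ ^ 2) = p * vy := by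
    rw [Measure.volume_eq_prod, integral_prod_mul
      (f := fun x => normalDensity vx μ x) (g := fun y => normalDensity vy μ y * ‖y - μ‖ ^ 2),
      integral_normalDensity hvx, integral_normalDensity_mul_norm_sub_sq hvy]
    simp
  have inner : ∀ x, ∫ y, normalDensity vx μ x * (normalDensity vy μ y * ‖y - x‖ ^ 2) =
      p * vy * normalDensity vx μ x + normalDensity vx μ x * ‖x - μ‖ ^ 2 := fun x => by
    rw [integral_const_mul, integral_normalDensity_mul_norm_sub_sq hvy, norm_sub_rev μ x]
    ring
  have iout : Integrable fun x => p * vy * normalDensity vx μ x +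
      normalDensity vx μ x * ‖x - μ‖ ^ 2 :=
    ((integrable_normalDensity hvx μ).const_mul _).add
      (integrable_normalDensity_mul_norm_sub_sq hvx μ μ)
  have m2 : Measurable (fun q : E p × E p => normalDensity vx μ q.1 *
      (normalDensity vy μ q.2 * ‖q.2 - q.1‖ ^ 2)) :=
    (measurable_normalDensity vx measurable_const measurable_fst).mul
      ((measurable_normalDensity vy measurable_const measurable_snd).mul (by fun_prop))
  have i2 : Integrable (fun q : E p × E p => normalDensity vx μ q.1 *
      (normalDensity vy μ q.2 * ‖q.2 - q.1‖ ^ 2)) := by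
    rw [Measure.volume_eq_prod, integrable_prod_iff m2.aestronglyMeasurable]
    refine ⟨ae_of_all _ fun x =>
      (integrable_normalDensity_mul_norm_sub_sq hvy μ x).const_mul (normalDensity vx μ x), ?_⟩
    refine iout.congr (ae_of_all _ fun x => ?_)
    simp only
    rw [← inner]
    refine integral_congr_ae (ae_of_all _ fun y => ?_)
    exact (Real.norm_of_nonneg
      (mul_nonneg (nx _ _) (mul_nonneg (ny _ _) (sq_nonneg _)))).symm
  have e2 : ∫ q : E p × E p, normalDensity vx μ q.1 *
      (normalDensity vy μ q.2 * ‖q.2 - q.1‖ ^ 2) = p * vy + p * vx := by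
    rw [Measure.volume_eq_prod] at i2 ⊢
    rw [integral_prod _ i2]
    simp only [inner]
    rw [integral_add ((integrable_normalDensity hvx μ).const_mul _)
      (integrable_normalDensity_mul_norm_sub_sq hvx μ μ), integral_const_mul,
      integral_normalDensity hvx, integral_normalDensity_mul_norm_sub_sq hvx]
    simp
  have h1 : ∀ q : E p × E p, normalDensity vx μ q.1 * normalDensity vy μ q.2 *
      Real.log (normalDensity vy μ q.2 / normalDensity (vx + vy) q.1 q.2) =
      p / 2 * Real.log ((vx + vy) / vy) * (normalDensity vx μ q.1 * normalDensity vy μ q.2)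
      - 1 / (2 * vy) * (normalDensity vx μ q.1 * (normalDensity vy μ q.2 * ‖q.2 - μ‖ ^ 2))
      + 1 / (2 * (vx + vy)) *
        (normalDensity vx μ q.1 * (normalDensity vy μ q.2 * ‖q.2 - q.1‖ ^ 2)) := fun q => by
    rw [log_normalDensity_div hs hvy]; ring
  have j1 : Integrable (fun q : E p × E p =>
      p / 2 * Real.log ((vx + vy) / vy) * (normalDensity vx μ q.1 * normalDensity vy μ q.2)
      - 1 / (2 * vy) * (normalDensity vx μ q.1 * (normalDensity vy μ q.2 * ‖q.2 - μ‖ ^ 2))) :=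
    (i0.const_mul _).sub (i1.const_mul _)
  simp_rw [h1]
  refine ⟨j1.add (i2.const_mul _), ?_⟩
  rw [integral_add j1 (i2.const_mul _), integral_sub (i0.const_mul _) (i1.const_mul _),
    integral_const_mul, integral_const_mul, integral_const_mul, e1, e2,
    integral_normalDensity_prod hvx hvy]
  field_simp
  ring

end Product

/-- If the Bayes predictive density comes from a prior with superharmonic (root) marginals, its
risk never exceeds the constant risk of the uniform-prior predictive density. -/
theorem klRisk_bayesDensity_le {π : Measure (E p)} {vx vy : ℝ} (hvx : 0 < vx) (hvy : 0 < vy)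
    (hπ : π ≠ 0) (hfin : ∀ z, marginal π vx z ≠ ∞)
    (hsuper : ∀ v ∈ Set.Icc (vx * vy / (vx + vy)) vx,
      Superharmonic (fun z => (marginal π v z).toReal) ∨
      Superharmonic (fun z => Real.sqrt (marginal π v z).toReal)) (μ : E p) :
    klRisk vx vy μ (bayesDensity π vx vy) ≤
      ENNReal.ofReal (p / 2 * Real.log ((vx + vy) / vy)) := by
  have hσ := sigmaFinite_of_marginal_ne_top hvx (hfin 0)
  have hpred := isPredictiveDensity_bayesDensity hvx hvy hπ hfin
  have hs : 0 < vx + vy := by positivity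
  set vw := vx * vy / (vx + vy) with hvw
  have hvw0 : 0 < vw := by positivity
  have hvwx : vw < vx := by
    rw [hvw, div_lt_iff₀ hs]
    nlinarith [mul_pos hvx hvx]
  set W : E p → E p → E p := fun x y => (vx + vy)⁻¹ • (vy • x + vx • y) with hW
  set Mx : E p → ℝ := fun x => (marginal π vx x).toReal with hMx
  set Mw : E p → ℝ := fun w => (marginal π vw w).toReal with hMw
  have hMx0 : ∀ x, 0 < Mx x := toReal_marginal_pos hπ hfin hvx le_rfl
  have hMw0 : ∀ w, 0 < Mw w := toReal_marginal_pos hπ hfin hvw0 hvwx.le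
  have hMxm : Measurable Mx := (measurable_marginal vx).ennreal_toReal
  have hMwm : Measurable Mw := (measurable_marginal vw).ennreal_toReal
  set g : E p → E p → ℝ := fun x y =>
    normalDensity (vx + vy) x y * Mw (W x y) / Mx x with hg
  have hg0 : ∀ x y, 0 < g x y := fun x y =>
    div_pos (mul_pos (normalDensity_pos hs _ _) (hMw0 _)) (hMx0 _)
  have hgm : Measurable fun q : E p × E p => g q.1 q.2 :=
    ((measurable_normalDensity _ measurable_fst measurable_snd).mul
      (hMwm.comp (by fun_prop : Measurable fun q : E p × E p => W q.1 q.2))).div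
      (hMxm.comp measurable_fst)
  have hbayes : ∀ x, bayesDensity π vx vy x = fun y => ENNReal.ofReal (g x y) := fun x => by
    funext y
    rw [bayesDensity_eq hvx hvy, hg, ENNReal.ofReal_div_of_pos (hMx0 x),
      ENNReal.ofReal_mul (normalDensity_nonneg hs _ _), hMw, hMx,
      ENNReal.ofReal_toReal (marginal_ne_top hfin hvw0 hvwx.le _),
      ENNReal.ofReal_toReal (hfin x), mul_comm, ENNReal.div_eq_inv_mul, mul_comm]
  have hg1 : ∀ x, ∫⁻ y, ENNReal.ofReal (g x y) = 1 := fun x => by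
    have := hpred.lintegral_eq_one x
    rwa [hbayes x] at this
  set NN : E p × E p → ℝ := fun q => normalDensity vx μ q.1 * normalDensity vy μ q.2 with hNN
  have hNxm : Measurable fun q : E p × E p => normalDensity vx μ q.1 :=
    measurable_normalDensity vx measurable_const measurable_fst
  have hNym : Measurable fun q : E p × E p => normalDensity vy μ q.2 :=
    measurable_normalDensity vy measurable_const measurable_snd
  -- A is the weighted log-ratio against the uniform-prior density, with corrections of total mass
  -- zero that keep the Bayes density g. Its integral is the constant risk, while h, the risk
  -- integrand of the Bayes density, differs from it only by the log-marginals.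
  set A : E p × E p → ℝ := fun q => NN q *
    Real.log (normalDensity vy μ q.2 / normalDensity (vx + vy) q.1 q.2) +
      normalDensity vx μ q.1 * g q.1 q.2 - NN q with hA
  set h : E p × E p → ℝ := fun q => A q +
    NN q * (Real.log (Mx q.1) - Real.log (Mw (W q.1 q.2))) with hh
  have hh_eq : ∀ x y, h (x, y) = normalDensity vx μ x *
      (normalDensity vy μ y * Real.log (normalDensity vy μ y / g x y) + g x y -
        normalDensity vy μ y) := fun x y => by
    have h1 : Real.log (normalDensity vy μ y / g x y) =
        Real.log (normalDensity vy μ y / normalDensity (vx + vy) x y) +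
          (Real.log (Mx x) - Real.log (Mw (W x y))) := by
      have n1 := (normalDensity_pos hvy μ y).ne'
      have n2 := (normalDensity_pos hs x y).ne'
      rw [hg, Real.log_div n1 (hg0 x y).ne', Real.log_div n1 n2,
        Real.log_div (mul_ne_zero n2 (hMw0 _).ne') (hMx0 _).ne',
        Real.log_mul n2 (hMw0 _).ne']
      ring
    rw [h1]
    simp only [hh, hA, hNN]
    ring
  have hh0 : ∀ q, 0 ≤ h q := fun q => by
    rw [← Prod.mk.eta (p := q), hh_eq]
    exact mul_nonneg (normalDensity_nonneg hvx _ _)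
      (mul_log_div_add_sub_nonneg (normalDensity_pos hvy _ _) (hg0 _ _))
  obtain ⟨iL, eL⟩ := integrable_and_integral_log_ratio hvx hvy μ
  have iN := integrable_normalDensity_prod hvx hvy μ
  have eN := integral_normalDensity_prod hvx hvy μ
  have hNg0 : ∀ q : E p × E p, 0 ≤ normalDensity vx μ q.1 * g q.1 q.2 := fun q =>
    mul_nonneg (normalDensity_nonneg hvx _ _) (hg0 _ _).le
  have lG : ∫⁻ q : E p × E p, ENNReal.ofReal (normalDensity vx μ q.1 * g q.1 q.2) = 1 := by
    rw [Measure.volume_eq_prod, lintegral_prod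
      (fun q : E p × E p => ENNReal.ofReal (normalDensity vx μ q.1 * g q.1 q.2))
      (hNxm.mul hgm).ennreal_ofReal.aemeasurable]
    simp_rw [ENNReal.ofReal_mul (normalDensity_nonneg hvx _ _)]
    simp_rw [lintegral_const_mul' _ _ ENNReal.ofReal_ne_top, hg1, mul_one]
    exact lintegral_normalDensity hvx μ
  have iG : Integrable fun q : E p × E p => normalDensity vx μ q.1 * g q.1 q.2 := by
    refine ⟨(hNxm.mul hgm).aestronglyMeasurable, ?_⟩
    rw [hasFiniteIntegral_iff_ofReal (ae_of_all _ hNg0), lG]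
    exact ENNReal.one_lt_top
  have eG : ∫ q : E p × E p, normalDensity vx μ q.1 * g q.1 q.2 = 1 := by
    rw [integral_eq_lintegral_of_nonneg_ae (ae_of_all _ hNg0)
      (hNxm.mul hgm).aestronglyMeasurable, lG, ENNReal.toReal_one]
  have iLG : Integrable fun q : E p × E p => NN q *
      Real.log (normalDensity vy μ q.2 / normalDensity (vx + vy) q.1 q.2) +
      normalDensity vx μ q.1 * g q.1 q.2 := iL.add iG
  have iA : Integrable A := iLG.sub iN
  have eA : ∫ q, A q = p / 2 * Real.log ((vx + vy) / vy) := by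
    rw [hA, integral_sub iLG iN, integral_add iL iG, eL, eG, eN]
    ring
  have hhm : Measurable h := by
    have m1 : Measurable A := by
      refine Measurable.sub (Measurable.add (Measurable.mul (hNxm.mul hNym) ?_)
        (hNxm.mul hgm)) (hNxm.mul hNym)
      exact (hNym.div (measurable_normalDensity _ measurable_fst measurable_snd)).log
    refine m1.add ((hNxm.mul hNym).mul (Measurable.sub ?_ ?_))
    · exact (hMxm.comp measurable_fst).log
    · exact (hMwm.comp (by fun_prop : Measurable fun q : E p × E p => W q.1 q.2)).log
  have hrisk : klRisk vx vy μ (bayesDensity π vx vy) = ∫⁻ q, ENNReal.ofReal (h q) := by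
    rw [Measure.volume_eq_prod, lintegral_prod _ hhm.ennreal_ofReal.aemeasurable]
    unfold klRisk
    refine lintegral_congr fun x => ?_
    rw [hbayes x, klLoss_eq_lintegral hvy μ hgm.of_uncurry_left (hg0 x) (hg1 x),
      ← lintegral_const_mul' _ _ ENNReal.ofReal_ne_top]
    refine lintegral_congr fun y => ?_
    rw [hh_eq, ← ENNReal.ofReal_mul (normalDensity_nonneg hvx _ _)]
  set k := (vx + vy) / vx with hk
  have hk0 : 0 < k := by positivity
  set T : E p × E p → E p × E p := fun q => (q.2, k • q.1 - (vy / vx) • q.2) with hT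
  have hTm : Measurable T := by fun_prop
  have hvol := volume_eq_smul_map (p := p) hk0 (vy / vx)
  have hkp : 0 ≤ k ^ p := by positivity
  have hkpne : ENNReal.ofReal (k ^ p) ≠ 0 := by simpa using pow_pos hk0 p
  have iAT : Integrable fun q => k ^ p * A (T q) := by
    have h1 := iA
    rw [hvol, integrable_smul_measure hkpne ENNReal.ofReal_ne_top] at h1
    exact (h1.comp_measurable hTm).const_mul _
  have eAT : ∫ q, k ^ p * A (T q) = p / 2 * Real.log ((vx + vy) / vy) := by
    have h1 := iA
    rw [hvol, integrable_smul_measure hkpne ENNReal.ofReal_ne_top] at h1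
    rw [integral_const_mul, ← eA]
    conv_rhs => rw [hvol, integral_smul_measure, ENNReal.toReal_ofReal hkp, smul_eq_mul]
    rw [integral_map hTm.aemeasurable h1.aestronglyMeasurable]
  have hWT : ∀ w x, W x (k • w - (vy / vx) • x) = w :=
    weighted_average_smul_sub hvx hvy
  -- In the coordinates (w, x) the joint density splits into the law of W and the conditional law
  -- N(w, (v_x − v_w)I) of X, so the log-marginal term has nonpositive mean for each w.
  have hhT : ∀ w x, k ^ p * h (T (w, x)) = k ^ p * A (T (w, x)) +
      normalDensity vw μ w * normalDensity (vx - vw) w x *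
        (Real.log (Mx x) - Real.log (Mw w)) := fun w x => by
    rw [← pow_mul_normalDensity_mul_normalDensity hvx hvy]
    simp only [hh, hT, hNN, hWT]
    ring
  have hδ : 0 < vx - vw := sub_pos.2 hvwx
  have hkey := integral_log_marginal_le hπ hfin hvw0 hvwx hsuper
  rw [hrisk, hvol, lintegral_smul_measure, lintegral_map hhm.ennreal_ofReal hTm, smul_eq_mul,
    ← lintegral_const_mul' _ _ ENNReal.ofReal_ne_top, Measure.volume_eq_prod,
    lintegral_prod (fun q => ENNReal.ofReal (k ^ p) * ENNReal.ofReal (h (T q)))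
      ((hhm.ennreal_ofReal.comp hTm).const_mul _).aemeasurable, ← eAT]
  simp_rw [← ENNReal.ofReal_mul hkp]
  simp_rw [hhT]
  exact lintegral_le_of_conditional_mean_nonpos (A := fun q => k ^ p * A (T q))
    (N₁ := fun w => normalDensity vw μ w) (F₁ := fun w => Real.log (Mw w))
    (F₂ := fun x => Real.log (Mx x)) (N₂ := fun w x => normalDensity (vx - vw) w x) iAT
    (fun w => normalDensity_nonneg hvw0 _ _) (fun w => integrable_normalDensity hδ w)
    (fun w => integral_normalDensity hδ w) (fun w => (hkey w).1) (fun w => (hkey w).2)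
    (fun w x => by rw [← hhT]; exact mul_nonneg hkp (hh0 _))

end Predictive

/-- The constant risk of the uniform-prior predictive density bounds the risk of the Bayes density
above at every μ and the maximal risk of every competitor below. -/
theorem theorem1 (p : ℕ) (vx vy : ℝ) (hvx : 0 < vx) (hvy : 0 < vy)
    (π : MeasureTheory.Measure (Predictive.E p)) (hπ : π ≠ 0)
    (hfin : ∀ z, Predictive.marginal π vx z ≠ ∞)
    (hsuper : ∀ v ∈ Set.Icc (vx * vy / (vx + vy)) vx,
      Predictive.Superharmonic (fun z => (Predictive.marginal π v z).toReal) ∨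
      Predictive.Superharmonic (fun z => Real.sqrt (Predictive.marginal π v z).toReal)) :
    Predictive.IsMinimax vx vy (Predictive.bayesDensity π vx vy) :=
  ⟨Predictive.isPredictiveDensity_bayesDensity hvx hvy hπ hfin, fun _ hq =>
    (iSup_le fun μ => Predictive.klRisk_bayesDensity_le hvx hvy hπ hfin hsuper μ).trans
      (Predictive.ofReal_log_le_iSup_klRisk hvx hvy hq)⟩
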